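/- Let $(\Omega,\mathcal F_\infty,(\mathcal F_t)_{t\in\mathbb R_+},P)$ be a filtered probability space satisfying the usual conditions (completeness and right continuity), where $\mathcal F_0$ is the $\sigma$-algebra generated by the $P$-null sets of $\mathcal F_\infty$. Stopping times take values in $[0,\infty]$, $\mathcal F_\tau=\{A\in\mathcal F_\infty:\ A\cap\{\tau\le t\}\in\mathcal F_t\ \forall t\in\mathbb R_+\}$, and $L^\infty(\mathcal F_\tau)=L^\infty(\Omega,\mathcal F_\tau,P)$; (in)equalities and limits of random variables are understood $P$-a.s. A *dynamic pricing procedure* is a family of maps $\Pi_{\sigma,\tau}:L^\infty(\mathcal F_\tau)\to L^\infty(\mathcal F_\sigma)$, indexed by the pairs of stopping times $\sigma\le\tau$, each of which is monotone, convex, normalized ($\Pi_{\sigma,\tau}(0)=0$) and translation invariant ($\Pi_{\sigma,\tau}(X+Z)=\Pi_{\sigma,\tau}(X)+Z$ for $Z\in L^\infty(\mathcal F_\sigma)$). It is *sublinear* if $\Pi_{\sigma,\tau}(\lambda X)=\lambda\Pi_{\sigma,\tau}(X)$ for all $\lambda>0$; *time-consistent* if $\Pi_{\nu,\sigma}(\Pi_{\sigma,\tau}(X))=\Pi_{\nu,\tau}(X)$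 for all $\nu\le\sigma\le\tau$ and $X\in L^\infty(\mathcal F_\tau)$; *continuous from below* if $\Pi_{\sigma,\tau}(X_n)\to\Pi_{\sigma,\tau}(X)$ whenever $X_n\in L^\infty(\mathcal F_\tau)$ is increasing with limit $X\in L^\infty(\mathcal F_\tau)$. A *TCPP* is a time-consistent dynamic pricing procedure that is continuous from below. Let $\mathcal C=\{\lambda X:\ \lambda\ge0,\ X\in L^\infty(\mathcal F_\infty),\ \Pi_{0,\infty}(X)\le0\}$. Let $\mathcal K=\{\lambda X:\lambda\ge0,\ X\in\mathcal K_0\}$, where $\mathcal K_0$ is the set of all $X_0+\sum_{i=1}^n(Z_i-Y_i)$ with $n\ge0$, $X_0,Y_i,Z_i\in L^\infty(\mathcal F_\infty)$, $\Pi_{0,\infty}(X_0)\le0$, and $\Pi_{\tau_i,\infty}(Z_i)\le-\Pi_{\tau_i,\infty}(-Y_i)$ for stopping times $0\le\tau_1\le\dots\le\tau_n<\infty$. The procedure has *No Static Free Lunch* (resp. *No Multiperiod Free Lunch*) if the $\sigma(L^\infty(P),L^1(P))$-closure of $\mathcal C$ (resp. of $\mathcal K$) meets $L^\infty_+(\mathcal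 F_\infty)$ only in $0$. A set $\mathcal Q$ of probability measures on $(\Omega,\mathcal F_\infty)$ equivalent to $P$ is *stable* if for all $Q,R\in\mathcal Q$ and every stopping time $\sigma$ the probability measure $S$ given by $S(A)=E_Q\big(E_R(1_A\mid\mathcal F_\sigma)\big)$, $A\in\mathcal F_\infty$, belongs to $\mathcal Q$. (1) If $(\Pi_{\sigma,\tau})$ is a sublinear TCPP with No Static Free Lunch or with No Multiperiod Free Lunch, then there is a non-empty stable set $\mathcal Q$ of probability measures equivalent to $P$ such that, for all stopping times $\sigma\le\tau$ and all $X\in L^\infty(\mathcal F_\tau)$, $$\Pi_{\sigma,\tau}(X)=\operatorname*{ess\,sup}_{Q\in\mathcal Q}E_Q(X\mid\mathcal F_\sigma).\qquad(*)$$ (2) Conversely, for every non-empty stable set $\mathcal Q$ of probability measures equivalent to $P$, formula $(*)$ defines a unique family of maps $\Pi_{\sigma,\tau}:L^\infty(\mathcal F_\tau)\to L^\infty(\mathcal F_\sigma)$, $\sigma\le\tau$, and this family is a sublinear TCPP with No Static Free Lunch and No Multiperiod Free Lunch. -/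

import Mathlib

open MeasureTheory Filter Topology
open scoped NNReal ENNReal

namespace Pricing

variable {Ω : Type*} {m : MeasurableSpace Ω}

/-- The standing assumptions on the filtered probability space `(Ω, F_∞, (F_t), P)`; the ambient
σ-algebra `m` plays the role of `F_∞`. -/
structure UsualConditions (𝓕 : Filtration ℝ≥0 m) (P : Measure Ω) : Prop where
  isComplete : P.IsComplete
  rightContinuous : 𝓕.IsRightContinuous
  /-- `F_0` is the σ-algebra generated by the `P`-null sets of `F_∞`. -/
  zero_eq : 𝓕 0 = MeasurableSpace.generateFrom {N | MeasurableSet[m] N ∧ P N = 0}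

/-- Stopping times with values in `[0, ∞]`, ordered pointwise. -/
abbrev StoppingTime (𝓕 : Filtration ℝ≥0 m) : Type _ :=
  {τ : Ω → WithTop ℝ≥0 // IsStoppingTime 𝓕 τ}

/-- The stopping time `0`. -/
def StoppingTime.zero (𝓕 : Filtration ℝ≥0 m) : StoppingTime 𝓕 :=
  ⟨fun _ => ((0 : ℝ≥0) : WithTop ℝ≥0), isStoppingTime_const 𝓕 0⟩

/-- The stopping time `∞`. -/
def StoppingTime.infty (𝓕 : Filtration ℝ≥0 m) : StoppingTime 𝓕 :=
  ⟨fun _ => ⊤, fun i => by simp⟩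

theorem StoppingTime.zero_le {𝓕 : Filtration ℝ≥0 m} (τ : StoppingTime 𝓕) :
    StoppingTime.zero 𝓕 ≤ τ := fun _ => bot_le

theorem StoppingTime.le_infty {𝓕 : Filtration ℝ≥0 m} (τ : StoppingTime 𝓕) :
    τ ≤ StoppingTime.infty 𝓕 := fun _ => le_top

/-- `F_τ = {A ∈ F_∞ | ∀ t, A ∩ {τ ≤ t} ∈ F_t}`. In contrast to `IsStoppingTime.measurableSpace`,
`A` ranges over the given `F_∞ = m`, which is not required to be generated by the `F_t`. -/
@[reducible]
def StoppingTime.sigma {𝓕 : Filtration ℝ≥0 m} (τ : StoppingTime 𝓕) : MeasurableSpace Ω where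
  MeasurableSet' s := MeasurableSet[m] s ∧
    ∀ t : ℝ≥0, MeasurableSet[𝓕 t] (s ∩ {ω | τ.1 ω ≤ (t : WithTop ℝ≥0)})
  measurableSet_empty := by simp
  measurableSet_compl s hs := by
    refine ⟨hs.1.compl, fun t => ?_⟩
    have h : sᶜ ∩ {ω | τ.1 ω ≤ (t : WithTop ℝ≥0)} =
        {ω | τ.1 ω ≤ (t : WithTop ℝ≥0)} \ (s ∩ {ω | τ.1 ω ≤ (t : WithTop ℝ≥0)}) := by
      ext ω; simp only [Set.mem_inter_iff, Set.mem_compl_iff, Set.mem_sdiff]; tauto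
    rw [h]
    exact (τ.2 t).diff (hs.2 t)
  measurableSet_iUnion s hs := by
    refine ⟨MeasurableSet.iUnion fun i => (hs i).1, fun t => ?_⟩
    rw [Set.iUnion_inter]
    exact MeasurableSet.iUnion fun i => (hs i).2 t

theorem StoppingTime.sigma_mono {𝓕 : Filtration ℝ≥0 m} {σ τ : StoppingTime 𝓕} (h : σ ≤ τ) :
    σ.sigma ≤ τ.sigma := by
  intro s hs
  refine ⟨hs.1, fun t => ?_⟩
  have e : s ∩ {ω | τ.1 ω ≤ (t : WithTop ℝ≥0)} =
      (s ∩ {ω | σ.1 ω ≤ (t : WithTop ℝ≥0)}) ∩ {ω | τ.1 ω ≤ (t : WithTop ℝ≥0)} := by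
    ext ω
    simp only [Set.mem_inter_iff, Set.mem_ofPred_eq]
    exact ⟨fun ⟨h1, h2⟩ => ⟨⟨h1, (h ω).trans h2⟩, h2⟩, fun ⟨⟨h1, _⟩, h2⟩ => ⟨h1, h2⟩⟩
  rw [e]
  exact (hs.2 t).inter (τ.2 t)

/-- `L^∞(F_τ)`, as the subspace of `L^∞(F_∞)` of the classes that have an `F_τ`-measurable
representative. -/
noncomputable abbrev LInf {𝓕 : Filtration ℝ≥0 m} (P : Measure Ω) (τ : StoppingTime 𝓕) :
    Submodule ℝ (Lp ℝ ∞ P) :=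
  lpMeas ℝ ℝ τ.sigma ∞ P

/-- The inclusion `L^∞(F_σ) ⊆ L^∞(F_τ)` for `σ ≤ τ`. -/
noncomputable def LInf.incl {𝓕 : Filtration ℝ≥0 m} (P : Measure Ω) {σ τ : StoppingTime 𝓕} (h : σ ≤ τ) :
    LInf P σ →ₗ[ℝ] LInf P τ :=
  Submodule.inclusion fun _ hf => mem_lpMeas_iff_aestronglyMeasurable.mpr
    ((mem_lpMeas_iff_aestronglyMeasurable.mp hf).mono (StoppingTime.sigma_mono h))

/-- A family of maps `Π_{σ,τ} : L^∞(F_τ) → L^∞(F_σ)`, for stopping times `σ ≤ τ`. -/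
noncomputable abbrev PriceFamily (𝓕 : Filtration ℝ≥0 m) (P : Measure Ω) : Type _ :=
  ∀ σ τ : StoppingTime 𝓕, σ ≤ τ → LInf P τ → LInf P σ

variable {𝓕 : Filtration ℝ≥0 m} {P : Measure Ω}

/-- Dynamic pricing procedures. The order on `L^∞` is the `P`-a.s. order of classes. -/
structure IsDynamicPricingProcedure (Φ : PriceFamily 𝓕 P) : Prop where
  monotone : ∀ σ τ (h : σ ≤ τ) (X Y : LInf P τ), X ≤ Y → Φ σ τ h X ≤ Φ σ τ h Y
  translation : ∀ σ τ (h : σ ≤ τ) (Z : LInf P σ) (X : LInf P τ),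
    Φ σ τ h (X + LInf.incl P h Z) = Φ σ τ h X + Z
  convex : ∀ σ τ (h : σ ≤ τ) (X Y : LInf P τ) (l : ℝ), 0 ≤ l → l ≤ 1 →
    Φ σ τ h (l • X + (1 - l) • Y) ≤ l • Φ σ τ h X + (1 - l) • Φ σ τ h Y
  normalized : ∀ σ τ (h : σ ≤ τ), Φ σ τ h 0 = 0

/-- Time consistency: `Π_{ν,σ}(Π_{σ,τ}(X)) = Π_{ν,τ}(X)` for `ν ≤ σ ≤ τ`. -/
def IsTimeConsistent (Φ : PriceFamily 𝓕 P) : Prop :=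
  ∀ ν σ τ (hνσ : ν ≤ σ) (hστ : σ ≤ τ) (X : LInf P τ),
    Φ ν σ hνσ (Φ σ τ hστ X) = Φ ν τ (hνσ.trans hστ) X

/-- Continuity from below, with respect to `P`-a.s. convergence of increasing sequences. -/
def IsContinuousFromBelow (Φ : PriceFamily 𝓕 P) : Prop :=
  ∀ σ τ (h : σ ≤ τ) (X : ℕ → LInf P τ) (Y : LInf P τ), Monotone X →
    (∀ᵐ ω ∂P, Tendsto (fun n => (X n : Lp ℝ ∞ P) ω) atTop (𝓝 ((Y : Lp ℝ ∞ P) ω))) →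
    ∀ᵐ ω ∂P, Tendsto (fun n => (Φ σ τ h (X n) : Lp ℝ ∞ P) ω) atTop
      (𝓝 ((Φ σ τ h Y : Lp ℝ ∞ P) ω))

/-- A TCPP: a time-consistent dynamic pricing procedure that is continuous from below. -/
structure IsTCPP (Φ : PriceFamily 𝓕 P) : Prop where
  isDynamicPricingProcedure : IsDynamicPricingProcedure Φ
  isTimeConsistent : IsTimeConsistent Φ
  isContinuousFromBelow : IsContinuousFromBelow Φ

/-- Sublinearity: `Π_{σ,τ}(λX) = λ Π_{σ,τ}(X)` for `λ > 0`. -/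
def IsSublinear (Φ : PriceFamily 𝓕 P) : Prop :=
  ∀ σ τ (h : σ ≤ τ) (l : ℝ), 0 < l → ∀ X : LInf P τ, Φ σ τ h (l • X) = l • Φ σ τ h X

/-- The weak* topology `σ(L^∞(P), L^1(P))`: the coarsest topology on `L^∞(P)` that makes
`X ↦ E_P(X g)` continuous for every `g ∈ L^1(P)`. -/
@[reducible]
noncomputable def weakStarTopology (P : Measure Ω) : TopologicalSpace (Lp ℝ ∞ P) :=
  TopologicalSpace.induced (fun (X : Lp ℝ ∞ P) (g : Lp ℝ 1 P) => ∫ ω, X ω * g ω ∂P)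
    Pi.topologicalSpace

/-- The price `Π_{τ,∞}`. -/
noncomputable abbrev PriceFamily.toInfty (Φ : PriceFamily 𝓕 P) (τ : StoppingTime 𝓕)
    (X : LInf P (StoppingTime.infty 𝓕)) : LInf P τ :=
  Φ τ (StoppingTime.infty 𝓕) τ.le_infty X

/-- The cone `C = {λX | λ ≥ 0, X ∈ L^∞(F_∞), Π_{0,∞}(X) ≤ 0}`. -/
def staticCone (Φ : PriceFamily 𝓕 P) : Set (Lp ℝ ∞ P) :=
  {Y | ∃ l : ℝ, 0 ≤ l ∧ ∃ X : LInf P (StoppingTime.infty 𝓕),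
    Φ.toInfty (StoppingTime.zero 𝓕) X ≤ 0 ∧ Y = l • (X : Lp ℝ ∞ P)}

/-- No Static Free Lunch: the weak* closure of `C` meets `L^∞_+` only in `0`. -/
def NoStaticFreeLunch (Φ : PriceFamily 𝓕 P) : Prop :=
  closure[weakStarTopology P] (staticCone Φ) ∩ {X | 0 ≤ X} = {0}

/-- The set `K_0` of the financial products attainable at zero cost via simple strategies. -/
def zeroCost (Φ : PriceFamily 𝓕 P) : Set (Lp ℝ ∞ P) :=
  {V | ∃ (n : ℕ) (τ : Fin n → StoppingTime 𝓕) (X₀ : LInf P (StoppingTime.infty 𝓕))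
      (Y Z : Fin n → LInf P (StoppingTime.infty 𝓕)),
    Monotone τ ∧ (∀ i ω, (τ i).1 ω < ⊤) ∧
    Φ.toInfty (StoppingTime.zero 𝓕) X₀ ≤ 0 ∧
    (∀ i, Φ.toInfty (τ i) (Z i) ≤ -Φ.toInfty (τ i) (-Y i)) ∧
    V = (X₀ : Lp ℝ ∞ P) + ∑ i, ((Z i : Lp ℝ ∞ P) - (Y i : Lp ℝ ∞ P))}

/-- The cone `K = {λX | λ ≥ 0, X ∈ K_0}`. -/
def multiperiodCone (Φ : PriceFamily 𝓕 P) : Set (Lp ℝ ∞ P) :=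
  {V | ∃ l : ℝ, 0 ≤ l ∧ ∃ X ∈ zeroCost Φ, V = l • X}

/-- No Multiperiod Free Lunch: the weak* closure of `K` meets `L^∞_+` only in `0`. -/
def NoMultiperiodFreeLunch (Φ : PriceFamily 𝓕 P) : Prop :=
  closure[weakStarTopology P] (multiperiodCone Φ) ∩ {X | 0 ≤ X} = {0}

/-- The set of the probability measures on `(Ω, F_∞)` that are equivalent to `P`. -/
def equivProb (P : Measure Ω) : Set (Measure Ω) :=
  {Q | IsProbabilityMeasure Q ∧ Q ≪ P ∧ P ≪ Q}

/-- Stability (m-stability): for `Q`, `R` in the set and a stopping time `σ` the set contains the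
measure `S` that follows `Q` up to `σ` and `R` after `σ`, i.e. `E_S(1_A) = E_Q(E_R(1_A | F_σ))`
for every `A ∈ F_∞`. In terms of the density processes `Z^Q`, `Z^R` with respect to `P` this is
`dS/dP = Z^Q_σ * Z^R_∞ / Z^R_σ`. As `σ` may take the value `∞`, this contains the stability
under switching from `Q` to `R` at `σ` on an event of `F_σ` only. -/
def IsStable (𝓕 : Filtration ℝ≥0 m) (𝒬 : Set (Measure Ω)) : Prop :=
  ∀ Q ∈ 𝒬, ∀ R ∈ 𝒬, ∀ σ : StoppingTime 𝓕, ∃ S ∈ 𝒬, ∀ A : Set Ω, MeasurableSet[m] A →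
    S.real A = ∫ ω, (R[A.indicator (fun _ => (1 : ℝ)) | σ.sigma]) ω ∂Q

/-- `Y` is the `P`-essential supremum of the set `s` of random variables. -/
def IsEssSup (P : Measure Ω) (s : Set (Ω → ℝ)) (Y : Ω → ℝ) : Prop :=
  (∀ f ∈ s, f ≤ᵐ[P] Y) ∧ ∀ Z : Ω → ℝ, AEMeasurable Z P → (∀ f ∈ s, f ≤ᵐ[P] Z) → Y ≤ᵐ[P] Z

/-- `Π_{σ,τ}(X) = esssup_{Q ∈ 𝒬} E_Q(X | F_σ)` for all `σ ≤ τ` and `X ∈ L^∞(F_τ)`. -/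
def IsRepresentedBy (Φ : PriceFamily 𝓕 P) (𝒬 : Set (Measure Ω)) : Prop :=
  ∀ σ τ (h : σ ≤ τ) (X : LInf P τ),
    IsEssSup P {f | ∃ Q ∈ 𝒬, f = Q[((X : Lp ℝ ∞ P) : Ω → ℝ) | σ.sigma]}
      ((Φ σ τ h X : Lp ℝ ∞ P) : Ω → ℝ)

end Pricing

open Pricing

/-! Part (1). Let C be the set of claims with Π_{0,∞}(X) ≤ 0 (`acceptanceCone`). Sublinearity makes
C a convex cone, monotonicity makes it solid downwards, and together with continuity from below this
closes it under bounded a.s. limits. Either no-free-lunch condition forces C ∩ L^∞_+ = {0}. The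
representing set consists of the equivalent probability measures under which every element of C has
nonpositive expectation (`pricingMeasures`). By a Kreps–Yan argument it is non-empty and determines
C (`IsAcceptanceCone.mem_of_forall_pricingMeasures`).

Locality and time consistency transfer this to every σ. For A in F_σ the claim 1_A(X - Π_σ(X)) has
price 0 at σ, hence lies in C, so E_Q(X | F_σ) ≤ Π_σ(X). If Z is the essential supremum of these
conditional expectations and A = {Z < Π_σ(X)}, then 1_A(X - Z) lies in C by the bipolar property.
Its price at σ, 1_A(Π_σ(X) - Z), is nonnegative and lies in C, hence vanishes, and A is null.
Stability is the same time consistency read through a pasting of two measures.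

The separation of X from C takes place in L². The set of D ≥ 0 with X - D in C is convex, Fatou
closed and misses 0; it is charged uniformly by a finite measure μ
(`IsFatouClosedConvex.exists_measure`). Consequently X has positive distance from C in L²(μ), where
Hahn–Banach applies.

Part (2). Stability makes the family E_Q(X | F_σ), Q in 𝒬, closed under maxima, so its essential
supremum is an a.s. limit of members; pasting then gives time consistency. Any single Q in 𝒬 is
nonpositive on K, hence on its weak* closure, and Q ~ P excludes free lunches. -/

namespace Pricing

/-! ### Separation of closed convex sets in Hilbert space -/

section Hilbert

open scoped Pointwise

variable {H : Type*} [NormedAddCommGroup H] [InnerProductSpace ℝ H] [CompleteSpace H]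

/-- A decreasing sequence of nonempty, closed, convex, bounded sets of a Hilbert space has a
common point. -/
theorem nonempty_iInter_of_antitone_closed_convex {A : ℕ → Set H} (hanti : Antitone A)
    (hne : ∀ n, (A n).Nonempty) (hcl : ∀ n, IsClosed (A n)) (hcv : ∀ n, Convex ℝ (A n))
    {R : ℝ} (hbd : ∀ x ∈ A 0, ‖x‖ ≤ R) : (⋂ n, A n).Nonempty := by
  have hmin : ∀ n, ∃ y ∈ A n, ∀ z ∈ A n, ‖y‖ ≤ ‖z‖ := by
    intro n
    obtain ⟨y, hy, h⟩ := exists_norm_eq_iInf_of_complete_convex (hne n) (hcl n).isComplete (hcv n) 0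
    refine ⟨y, hy, fun z hz => ?_⟩
    have h1 : ‖(0 : H) - y‖ ≤ ‖(0 : H) - z‖ := by
      rw [h]
      exact ciInf_le (f := fun w : A n => ‖(0 : H) - w‖)
        ⟨0, by rintro _ ⟨w, rfl⟩; exact norm_nonneg _⟩ ⟨z, hz⟩
    simpa using h1
  choose y hy hle using hmin
  have hmono : Monotone fun n => ‖y n‖ ^ 2 := fun n k hnk =>
    pow_le_pow_left₀ (norm_nonneg _) (hle n _ (hanti hnk (hy k))) 2
  have hbdd : BddAbove (Set.range fun n => ‖y n‖ ^ 2) := by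
    refine ⟨R ^ 2, ?_⟩
    rintro _ ⟨n, rfl⟩
    exact pow_le_pow_left₀ (norm_nonneg _) (hbd _ (hanti (Nat.zero_le n) (hy n))) 2
  have hlim := tendsto_atTop_ciSup hmono hbdd
  -- `y n` has minimal norm in `A n`, and the midpoint of `y n` and `y k` also lies there; the
  -- parallelogram law turns this into a Cauchy estimate.
  have key : ∀ n k, n ≤ k → ‖y k - y n‖ ^ 2 ≤ 2 * (‖y k‖ ^ 2 - ‖y n‖ ^ 2) := by
    intro n k hnk
    have hm : (1 / 2 : ℝ) • y n + (1 / 2 : ℝ) • y k ∈ A n :=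
      hcv n (hy n) (hanti hnk (hy k)) (by norm_num) (by norm_num) (by norm_num)
    have h1 := hle n _ hm
    rw [← smul_add, norm_smul] at h1
    have h2 : 2 * ‖y n‖ ≤ ‖y k + y n‖ := by
      rw [add_comm (y k)]
      norm_num at h1
      linarith
    have h3 := parallelogram_law_with_norm ℝ (y k) (y n)
    nlinarith [norm_nonneg (y n)]
  have hcau : CauchySeq y := by
    rw [Metric.cauchySeq_iff']
    intro ε hε
    have hc := Metric.cauchySeq_iff'.1 hlim.cauchySeq (ε ^ 2 / 2) (by positivity)
    obtain ⟨N, hN⟩ := hc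
    refine ⟨N, fun n hn => ?_⟩
    have h1 := hN n hn
    rw [Real.dist_eq] at h1
    have h2 := key N n hn
    rw [dist_eq_norm]
    refine lt_of_pow_lt_pow_left₀ 2 hε.le ?_
    have := (abs_lt.1 h1).2
    linarith
  obtain ⟨x, hx⟩ := cauchySeq_tendsto_of_complete hcau
  refine ⟨x, Set.mem_iInter.2 fun n => ?_⟩
  exact (hcl n).mem_of_tendsto hx ((eventually_ge_atTop n).mono fun k hk => hanti hk (hy k))

/-- Strict separation of disjoint closed convex sets of a Hilbert space, one of them bounded. -/
theorem exists_strict_separation {K B : Set H} (hK : IsClosed K) (hB : IsClosed B)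
    (hKc : Convex ℝ K) (hBc : Convex ℝ B) {R : ℝ} (hbd : ∀ x ∈ K, ‖x‖ ≤ R)
    (hdisj : ∀ x ∈ K, x ∉ B) :
    ∃ (f : H) (u : ℝ), 0 < u ∧ ∀ k ∈ K, ∀ b ∈ B, inner ℝ f b + u < inner ℝ f k := by
  have h0 : (0 : H) ∉ closure (K - B) := by
    intro h
    -- If K - B came arbitrarily close to 0, every closed thickening of B would meet K. These
    -- intersections are nested, convex and bounded, so they share a point, which must lie in B.
    have hne : (⋂ n : ℕ, K ∩ Metric.cthickening (1 / ((n : ℝ) + 1)) B).Nonempty := by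
      refine nonempty_iInter_of_antitone_closed_convex (R := R) ?_ ?_ ?_ ?_ ?_
      · intro n k hnk
        exact Set.inter_subset_inter_right _
          (Metric.cthickening_mono (Nat.one_div_le_one_div hnk) _)
      · intro n
        obtain ⟨z, hz, hd⟩ := Metric.mem_closure_iff.1 h (1 / ((n : ℝ) + 1)) (by positivity)
        obtain ⟨k, hk, b, hb, rfl⟩ := Set.mem_sub.1 hz
        refine ⟨k, hk, Metric.mem_cthickening_of_dist_le k b _ _ hb ?_⟩
        rw [dist_eq_norm]
        rw [dist_eq_norm, zero_sub, norm_neg] at hd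
        exact hd.le
      · exact fun n => hK.inter Metric.isClosed_cthickening
      · exact fun n => hKc.inter (hBc.cthickening _)
      · exact fun x hx => hbd x hx.1
    obtain ⟨x, hx⟩ := hne
    rw [Set.mem_iInter] at hx
    refine hdisj x (hx 0).1 ?_
    rw [← hB.closure_eq, Metric.closure_eq_iInter_cthickening]
    simp only [Set.mem_iInter]
    intro ε hε
    obtain ⟨n, hn⟩ := exists_nat_one_div_lt hε
    exact Metric.cthickening_mono hn.le _ (hx n).2
  obtain ⟨f, u, hu, hf⟩ := geometric_hahn_banach_point_closed
    (hKc.sub hBc).closure isClosed_closure h0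
  refine ⟨(InnerProductSpace.toDual ℝ H).symm f, u, by simpa using hu, fun k hk b hb => ?_⟩
  have := hf (k - b) (subset_closure (Set.sub_mem_sub hk hb))
  rw [map_sub] at this
  simp only [InnerProductSpace.toDual_symm_apply]
  linarith

end Hilbert

end Pricing

namespace Pricing

variable {Ω : Type*} {m : MeasurableSpace Ω} {P : Measure Ω}

/-! ### L² weights that charge the bounded parts of a convex set -/

section BoundedSets

theorem inner_L2_eq (f g : Lp ℝ 2 P) : inner ℝ f g = ∫ ω, f ω * g ω ∂P := by
  rw [L2.inner_def]
  refine integral_congr_ae (Eventually.of_forall fun ω => ?_)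
  simp [mul_comm]

theorem inner_L2_nonneg {f g : Lp ℝ 2 P} (hf : 0 ≤ f) (hg : 0 ≤ g) : 0 ≤ inner ℝ f g := by
  rw [inner_L2_eq]
  refine integral_nonneg_of_ae ?_
  filter_upwards [(Lp.coeFn_nonneg f).2 hf, (Lp.coeFn_nonneg g).2 hg] with ω h1 h2
  exact mul_nonneg h1 h2

/-- The elements of `S ⊆ L^∞` that are bounded above by `N`, as a subset of `L²`. -/
def boundedPart (S : Set (Lp ℝ ∞ P)) (N : ℝ) : Set (Lp ℝ 2 P) :=
  {D | ∃ D' ∈ S, D' =ᵐ[P] D ∧ ∀ᵐ ω ∂P, D' ω ≤ N}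

/-- `S` is a convex set of nonnegative elements of `L^∞`, closed under bounded a.s. limits. -/
structure IsFatouClosedConvex (S : Set (Lp ℝ ∞ P)) : Prop where
  convex : Convex ℝ S
  nonneg : ∀ D ∈ S, 0 ≤ D
  closed : ∀ (D : ℕ → Lp ℝ ∞ P) (D' : Lp ℝ ∞ P) (N : ℝ), (∀ n, D n ∈ S) →
    (∀ n, ∀ᵐ ω ∂P, D n ω ≤ N) → (∀ᵐ ω ∂P, Tendsto (fun n => D n ω) atTop (𝓝 (D' ω))) → D' ∈ S

variable {S : Set (Lp ℝ ∞ P)}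

theorem boundedPart_nonneg (hS : IsFatouClosedConvex S) {N : ℝ} {D : Lp ℝ 2 P}
    (hD : D ∈ boundedPart S N) : 0 ≤ D := by
  obtain ⟨D', h1, h2, -⟩ := hD
  rw [← Lp.coeFn_nonneg]
  filter_upwards [h2, (Lp.coeFn_nonneg D').2 (hS.nonneg _ h1)] with ω h3 h4
  rw [← h3]; exact h4

theorem boundedPart_le {N : ℝ} {D : Lp ℝ 2 P}
    (hD : D ∈ boundedPart S N) : ∀ᵐ ω ∂P, D ω ≤ N := by
  obtain ⟨D', h1, h2, h3⟩ := hD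
  filter_upwards [h2, h3] with ω h4 h5
  rwa [← h4]

theorem norm_L2_le_of_ae_abs_le [IsProbabilityMeasure P] {N : ℝ} (D : Lp ℝ 2 P) (h : ∀ᵐ ω ∂P, |D ω| ≤ N) :
    ‖D‖ ≤ |N| := by
  have h1 := Lp.norm_le_of_ae_bound (f := D) (C := |N|) (abs_nonneg N)
    (by filter_upwards [h] with ω hω; exact hω.trans (le_abs_self N))
  simpa [measureUnivNNReal] using h1

/-- An L²-convergent sequence has an a.s. convergent subsequence. Its terms lie between 0 and N, so
the limit is bounded and Fatou closedness applies. -/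
theorem isClosed_boundedPart (hS : IsFatouClosedConvex S) (N : ℝ) :
    IsClosed (boundedPart S N) := by
  refine IsSeqClosed.isClosed fun D D₀ hD hlim => ?_
  have hmeas : TendstoInMeasure P (fun n => (D n : Ω → ℝ)) atTop D₀ :=
    tendstoInMeasure_of_tendsto_Lp hlim
  obtain ⟨ns, hns, hae⟩ := hmeas.exists_seq_tendsto_ae
  choose D' hD'S hD'D hD'N using hD
  have hlim' : ∀ᵐ ω ∂P, Tendsto (fun n => D' (ns n) ω) atTop (𝓝 (D₀ ω)) := by
    filter_upwards [hae, ae_all_iff.2 hD'D] with ω h1 h2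
    simpa only [h2] using h1
  have hnn : ∀ᵐ ω ∂P, ∀ n, 0 ≤ D' n ω :=
    ae_all_iff.2 fun n => (Lp.coeFn_nonneg _).2 (hS.nonneg _ (hD'S n))
  have hle : ∀ᵐ ω ∂P, D₀ ω ≤ N := by
    filter_upwards [hlim', ae_all_iff.2 hD'N] with ω h1 h2
    exact le_of_tendsto' h1 fun n => h2 _
  have hge : ∀ᵐ ω ∂P, 0 ≤ D₀ ω := by
    filter_upwards [hlim', hnn] with ω h1 h2
    exact ge_of_tendsto' h1 fun n => h2 _
  have hmem : MemLp (D₀ : Ω → ℝ) ∞ P := by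
    refine memLp_top_of_bound (Lp.aestronglyMeasurable D₀) N ?_
    filter_upwards [hle, hge] with ω h1 h2
    rwa [Real.norm_eq_abs, abs_of_nonneg h2]
  refine ⟨hmem.toLp _, hS.closed (fun n => D' (ns n)) _ N (fun n => hD'S _) (fun n => hD'N _) ?_,
    hmem.coeFn_toLp, ?_⟩
  · filter_upwards [hlim', hmem.coeFn_toLp] with ω h1 h2
    rwa [h2]
  · filter_upwards [hle, hmem.coeFn_toLp] with ω h1 h2
    rwa [h2]

theorem convex_boundedPart (hS : IsFatouClosedConvex S) (N : ℝ) :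
    Convex ℝ (boundedPart S N) := by
  rintro D ⟨D', h1, h2, h3⟩ E ⟨E', k1, k2, k3⟩ a b ha hb hab
  refine ⟨a • D' + b • E', hS.convex h1 k1 ha hb hab, ?_, ?_⟩
  · filter_upwards [h2, k2, Lp.coeFn_add (a • D') (b • E'), Lp.coeFn_smul a D', Lp.coeFn_smul b E',
      Lp.coeFn_add (a • D) (b • E), Lp.coeFn_smul a D, Lp.coeFn_smul b E] with ω e1 e2 e3 e4 e5 e6 e7 e8
    simp only [e1, e2, e3, e4, e5, e6, e7, e8, Pi.add_apply, Pi.smul_apply]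
  · filter_upwards [h3, k3, Lp.coeFn_add (a • D') (b • E'), Lp.coeFn_smul a D',
      Lp.coeFn_smul b E'] with ω e1 e2 e3 e4 e5
    simp only [e3, e4, e5, Pi.add_apply, Pi.smul_apply, smul_eq_mul]
    calc a * D' ω + b * E' ω ≤ a * N + b * N :=
          add_le_add (mul_le_mul_of_nonneg_left e1 ha) (mul_le_mul_of_nonneg_left e2 hb)
      _ = N := by rw [← add_mul, hab, one_mul]

/-- A weight that charges `boundedPart S N` can be enlarged, at the cost `1 / N`, so as to charge
`boundedPart S N'`. -/
theorem exists_weight_step [IsProbabilityMeasure P] (hS : IsFatouClosedConvex S) (N N' : ℝ) (hN : 0 ≤ N) (w : Lp ℝ 2 P)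
    (hw0 : 0 ≤ w) (hw : ∀ D ∈ boundedPart S N, 1 < inner ℝ w D) :
    ∃ v : Lp ℝ 2 P, 0 ≤ v ∧ N * ∫ ω, v ω ∂P ≤ 1 ∧
      ∀ D ∈ boundedPart S N', 1 < inner ℝ (w + v) D := by
  -- K collects the elements that `w` does not charge yet, B is the order interval [0, N]. They are
  -- disjoint, because `w` already charges the elements of S bounded by N. A functional separating K
  -- from B yields the correction `v`.
  set K : Set (Lp ℝ 2 P) := boundedPart S N' ∩ {D | inner ℝ w D ≤ 1} with hKdef
  set B : Set (Lp ℝ 2 P) := {D | 0 ≤ D ∧ ∀ᵐ ω ∂P, D ω ≤ N} with hBdef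
  have hconst : MemLp (fun _ : Ω => N) 2 P := memLp_const N
  have hBIcc : B = Set.Icc 0 (hconst.toLp _) := by
    ext D
    simp only [hBdef, Set.mem_ofPred_eq, Set.mem_Icc, ← Lp.coeFn_le D]
    refine and_congr_right fun _ => ?_
    constructor
    · intro h
      filter_upwards [h, hconst.coeFn_toLp] with ω h1 h2
      rwa [h2]
    · intro h
      filter_upwards [h, hconst.coeFn_toLp] with ω h1 h2
      rwa [h2] at h1
  have hBcl : IsClosed B := hBIcc ▸ isClosed_Icc
  have hBcv : Convex ℝ B := by
    rintro D ⟨h1, h2⟩ E ⟨k1, k2⟩ a b ha hb hab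
    rw [← Lp.coeFn_nonneg] at h1 k1
    refine ⟨(Lp.coeFn_nonneg _).1 ?_, ?_⟩
    · filter_upwards [h1, k1, Lp.coeFn_add (a • D) (b • E), Lp.coeFn_smul a D,
        Lp.coeFn_smul b E] with ω e1 e2 e3 e4 e5
      simp only [e3, e4, e5, Pi.add_apply, Pi.smul_apply, smul_eq_mul, Pi.zero_apply] at e1 e2 ⊢
      positivity
    · filter_upwards [h2, k2, Lp.coeFn_add (a • D) (b • E), Lp.coeFn_smul a D,
        Lp.coeFn_smul b E] with ω e1 e2 e3 e4 e5
      simp only [e3, e4, e5, Pi.add_apply, Pi.smul_apply, smul_eq_mul]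
      calc a * D ω + b * E ω ≤ a * N + b * N :=
            add_le_add (mul_le_mul_of_nonneg_left e1 ha) (mul_le_mul_of_nonneg_left e2 hb)
        _ = N := by rw [← add_mul, hab, one_mul]
  have hKcl : IsClosed K := (isClosed_boundedPart hS N').inter
    (isClosed_le (by fun_prop) continuous_const)
  have hKcv : Convex ℝ K := (convex_boundedPart hS N').inter <| by
    intro D hD E hE a b ha hb hab
    simp only [Set.mem_ofPred_eq, inner_add_right, inner_smul_right] at hD hE ⊢
    nlinarith
  have hKbd : ∀ D ∈ K, ‖D‖ ≤ |N'| := by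
    intro D hD
    refine norm_L2_le_of_ae_abs_le D ?_
    filter_upwards [boundedPart_le hD.1,
      (Lp.coeFn_nonneg _).2 (boundedPart_nonneg hS hD.1)] with ω h1 h2
    rwa [abs_of_nonneg h2]
  have hdisj : ∀ D ∈ K, D ∉ B := by
    rintro D ⟨⟨D', h1, h2, h3⟩, h4⟩ ⟨-, h5⟩
    refine absurd (hw D ⟨D', h1, h2, ?_⟩) (not_lt.2 h4)
    filter_upwards [h2, h5] with ω h6 h7
    rwa [h6]
  obtain ⟨f, u, hu, hf⟩ := exists_strict_separation hKcl hBcl hKcv hBcv hKbd hdisj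
  -- the element of `B` that maximizes `⟪f, ·⟫`
  have hfm : AEStronglyMeasurable (f : Ω → ℝ) P := Lp.aestronglyMeasurable f
  obtain ⟨f', hf'm, hf'⟩ := hfm
  have hAm : MeasurableSet {ω | 0 < f' ω} := measurableSet_lt measurable_const hf'm.measurable
  set b : Lp ℝ 2 P := indicatorConstLp 2 hAm (measure_ne_top P _) N with hb
  have hbco : ∀ᵐ ω ∂P, b ω = Set.indicator {ω | 0 < f' ω} (fun _ => N) ω := indicatorConstLp_coeFn
  have hbB : b ∈ B := by
    refine ⟨(Lp.coeFn_nonneg _).1 ?_, ?_⟩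
    · filter_upwards [hbco] with ω h
      rw [h]; exact Set.indicator_nonneg (fun _ _ => hN) ω
    · filter_upwards [hbco] with ω h
      rw [h]; exact Set.indicator_le_self' (fun _ _ => hN) ω
  have hpos : ∀ᵐ ω ∂P, (f ⊔ 0 : Lp ℝ 2 P) ω = max (f ω) 0 := by
    filter_upwards [Lp.coeFn_sup f 0, Lp.coeFn_zero ℝ 2 P] with ω h1 h2
    rw [h1, Pi.sup_apply, h2]; rfl
  have hfb : inner ℝ f b = N * ∫ ω, (f ⊔ 0 : Lp ℝ 2 P) ω ∂P := by
    rw [inner_L2_eq, ← integral_const_mul]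
    refine integral_congr_ae ?_
    filter_upwards [hbco, hpos, hf'] with ω h1 h2 h3
    rw [h1, h2, h3]
    by_cases h : 0 < f' ω
    · simp [Set.indicator, h, max_eq_left h.le, mul_comm]
    · simp [Set.indicator, h, max_eq_right (not_lt.1 h)]
  have hint0 : 0 ≤ ∫ ω, (f ⊔ 0 : Lp ℝ 2 P) ω ∂P :=
    integral_nonneg_of_ae ((Lp.coeFn_nonneg _).2 le_sup_right)
  -- On K the functional exceeds t, while N ∫ f⁺ = ⟪f, b⟫ < t. Division of f⁺ by t therefore gives
  -- both required bounds.
  set t : ℝ := inner ℝ f b + u with ht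
  have htpos : 0 < t := by rw [ht, hfb]; positivity
  refine ⟨t⁻¹ • (f ⊔ 0), ?_, ?_, ?_⟩
  · rw [← Lp.coeFn_nonneg]
    filter_upwards [Lp.coeFn_smul t⁻¹ (f ⊔ 0), hpos] with ω h1 h2
    rw [h1, Pi.smul_apply, h2, smul_eq_mul]
    exact mul_nonneg (by positivity) (le_max_right _ _)
  · have : ∫ ω, (t⁻¹ • (f ⊔ 0) : Lp ℝ 2 P) ω ∂P = t⁻¹ * ∫ ω, (f ⊔ 0 : Lp ℝ 2 P) ω ∂P := by
      rw [← integral_const_mul]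
      refine integral_congr_ae ?_
      filter_upwards [Lp.coeFn_smul t⁻¹ (f ⊔ 0)] with ω h1
      rw [h1]; rfl
    rw [this, mul_left_comm, ← hfb, inv_mul_le_iff₀ htpos]
    linarith
  · intro D hD
    have hD0 := boundedPart_nonneg hS hD
    have hle : inner ℝ f D ≤ inner ℝ (f ⊔ 0) D := by
      have : 0 ≤ inner ℝ (f ⊔ 0 - f) D := inner_L2_nonneg (sub_nonneg.2 le_sup_left) hD0
      rw [inner_sub_left] at this
      linarith
    rw [inner_add_left, real_inner_smul_left]
    by_cases h : inner ℝ w D ≤ 1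
    · have h1 := hf D ⟨hD, h⟩ b hbB
      have h2 : 1 < t⁻¹ * inner ℝ (f ⊔ 0) D := by
        rw [lt_inv_mul_iff₀ htpos]; linarith
      have h3 := inner_L2_nonneg hw0 hD0
      linarith
    · have h1 : 0 ≤ t⁻¹ * inner ℝ (f ⊔ 0) D :=
        mul_nonneg (by positivity) (inner_L2_nonneg le_sup_right hD0)
      linarith

end BoundedSets

end Pricing

/-! ### Charging a Fatou closed convex set by a finite measure -/

namespace Pricing

variable {Ω : Type*} {m : MeasurableSpace Ω} {P : Measure Ω}

theorem ae_abs_le_norm (X : Lp ℝ ∞ P) : ∀ᵐ ω ∂P, |X ω| ≤ ‖X‖ := by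
  filter_upwards [ae_le_eLpNormEssSup (f := (X : Ω → ℝ)) (μ := P)] with ω h
  rw [Lp.norm_def, eLpNorm_exponent_top, ← Real.norm_eq_abs, ← toReal_enorm]
  refine ENNReal.toReal_mono ?_ h
  rw [← eLpNorm_exponent_top]
  exact Lp.eLpNorm_ne_top X

theorem memLp_of_absolutelyContinuous {Q : Measure Ω} [IsFiniteMeasure Q] (hQ : Q ≪ P)
    (X : Lp ℝ ∞ P) (p : ℝ≥0∞) : MemLp (X : Ω → ℝ) p Q :=
  MemLp.of_bound ((Lp.aestronglyMeasurable X).mono_ac hQ) ‖X‖ (hQ.ae_le (ae_abs_le_norm X))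

theorem integrable_of_absolutelyContinuous {Q : Measure Ω} [IsFiniteMeasure Q] (hQ : Q ≪ P)
    (X : Lp ℝ ∞ P) : Integrable (X : Ω → ℝ) Q :=
  memLp_one_iff_integrable.1 (memLp_of_absolutelyContinuous hQ X 1)

/-- A convex set of nonnegative bounded functions that is closed under bounded a.s. limits and does
not contain `0` is strictly separated from `0` by a finite measure. -/
theorem IsFatouClosedConvex.exists_measure [IsProbabilityMeasure P] {S : Set (Lp ℝ ∞ P)}
    (hS : IsFatouClosedConvex S) (h0 : (0 : Lp ℝ ∞ P) ∉ S) :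
    ∃ μ : Measure Ω, IsFiniteMeasure μ ∧ μ ≪ P ∧ ∀ D ∈ S, 1 < ∫ ω, D ω ∂μ := by
  let T : ℕ → Type _ := fun n =>
    {w : Lp ℝ 2 P // 0 ≤ w ∧ ∀ D ∈ boundedPart S ((2 : ℝ) ^ n), 1 < inner ℝ w D}
  have hinit : Nonempty (T 0) := by
    -- The bound N = 0 with zero weight is a valid start: only D = 0 is nonnegative and bounded by
    -- 0, and 0 is not in S.
    obtain ⟨v, hv0, -, hv⟩ := exists_weight_step hS 0 (2 ^ 0) le_rfl 0 le_rfl <| by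
      intro D hD
      have hge := boundedPart_nonneg hS hD
      obtain ⟨D', h1, h2, h3⟩ := hD
      refine absurd h1 ?_
      have : D' = 0 := by
        refine le_antisymm ?_ (hS.nonneg _ h1)
        rw [← Lp.coeFn_le]
        filter_upwards [h3, Lp.coeFn_zero ℝ ∞ P] with ω h4 h5
        rw [h5]; exact h4
      rwa [this]
    exact ⟨⟨v, hv0, by simpa using hv⟩⟩
  have hstep : ∀ n (w : T n), ∃ (w' : T (n + 1)) (v : Lp ℝ 2 P), 0 ≤ v ∧
      (2 : ℝ) ^ n * ∫ ω, v ω ∂P ≤ 1 ∧ w'.1 = w.1 + v := by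
    intro n w
    obtain ⟨v, hv0, hv1, hv⟩ := exists_weight_step hS (2 ^ n) (2 ^ (n + 1)) (by positivity)
      w.1 w.2.1 w.2.2
    exact ⟨⟨w.1 + v, add_nonneg w.2.1 hv0, hv⟩, v, hv0, hv1, rfl⟩
  choose next inc hinc0 hinc1 hinc using hstep
  let w : ∀ n, T n := fun n => Nat.rec hinit.some (fun k x => next k x) n
  have hwsucc : ∀ n, w (n + 1) = next n (w n) := fun n => rfl
  let v : ℕ → Lp ℝ 2 P := fun n => inc n (w n)
  have hv0 : ∀ n, 0 ≤ v n := fun n => hinc0 n _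
  have hwv : ∀ n, (w (n + 1)).1 = (w n).1 + v n := fun n => hinc n (w n)
  -- The n-th correction has integral at most 2⁻ⁿ, so the limiting density is integrable; it
  -- dominates every `w n`.
  let W : Ω → ℝ≥0∞ := fun ω => ENNReal.ofReal ((w 0).1 ω) + ∑' n, ENNReal.ofReal (v n ω)
  have hmeas : ∀ g : Lp ℝ 2 P, AEMeasurable (fun ω => ENNReal.ofReal (g ω)) P := fun g =>
    (Lp.aestronglyMeasurable g).aemeasurable.ennreal_ofReal
  have hWm : AEMeasurable W P := (hmeas _).add (AEMeasurable.tsum fun n => hmeas _)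
  have hint : ∀ g : Lp ℝ 2 P, Integrable (g : Ω → ℝ) P := fun g =>
    (Lp.memLp g).integrable (by norm_num)
  have hWfin : ∫⁻ ω, W ω ∂P ≠ ∞ := by
    rw [lintegral_add_left' (hmeas _), lintegral_tsum fun n => hmeas _]
    refine ENNReal.add_ne_top.2 ⟨?_, ?_⟩
    · rw [← ofReal_integral_eq_lintegral_ofReal (hint _) ((Lp.coeFn_nonneg _).2 (w 0).2.1)]
      exact ENNReal.ofReal_ne_top
    · refine ne_top_of_le_ne_top (b := ∑' n : ℕ, ENNReal.ofReal ((1 / 2 : ℝ) ^ n)) ?_ ?_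
      · rw [← ENNReal.ofReal_tsum_of_nonneg (fun n => by positivity) summable_geometric_two]
        exact ENNReal.ofReal_ne_top
      · refine ENNReal.tsum_le_tsum fun n => ?_
        rw [← ofReal_integral_eq_lintegral_ofReal (hint _) ((Lp.coeFn_nonneg _).2 (hv0 n))]
        refine ENNReal.ofReal_le_ofReal ?_
        have h1 : (2 : ℝ) ^ n * ∫ ω, v n ω ∂P ≤ 1 := hinc1 n (w n)
        rw [one_div, inv_pow, ← one_div, le_div_iff₀ (by positivity), mul_comm]
        exact h1
  have hfin : IsFiniteMeasure (P.withDensity W) := isFiniteMeasure_withDensity hWfin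
  have hac : P.withDensity W ≪ P := withDensity_absolutelyContinuous _ _
  have hwle : ∀ᵐ ω ∂P, ∀ n, ENNReal.ofReal ((w n).1 ω) ≤
      ENNReal.ofReal ((w 0).1 ω) + ∑ k ∈ Finset.range n, ENNReal.ofReal (v k ω) := by
    have hadd : ∀ᵐ ω ∂P, ∀ n, (w (n + 1)).1 ω = (w n).1 ω + v n ω := by
      refine ae_all_iff.2 fun n => ?_
      rw [hwv]
      exact Lp.coeFn_add _ _
    filter_upwards [hadd] with ω h n
    induction n with
    | zero => simp
    | succ n ih =>
      rw [h, Finset.sum_range_succ, ← add_assoc]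
      exact ENNReal.ofReal_add_le.trans (by gcongr)
  refine ⟨P.withDensity W, hfin, hac, fun D hD => ?_⟩
  have hD0 : 0 ≤ᵐ[P] D := (Lp.coeFn_nonneg _).2 (hS.nonneg D hD)
  have hD2 : MemLp (D : Ω → ℝ) 2 P := memLp_of_absolutelyContinuous .rfl D 2
  obtain ⟨n, hn⟩ := pow_unbounded_of_one_lt ‖D‖ (one_lt_two (α := ℝ))
  have h1 : 1 < inner ℝ (w n).1 (hD2.toLp _) := by
    refine (w n).2.2 _ ⟨D, hD, hD2.coeFn_toLp.symm, ?_⟩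
    filter_upwards [ae_abs_le_norm D] with ω h
    exact (le_abs_self _).trans (h.trans hn.le)
  rw [inner_L2_eq] at h1
  have hmulint : Integrable (fun ω => (w n).1 ω * hD2.toLp _ ω) P :=
    (Lp.memLp (w n).1).integrable_mul (Lp.memLp _)
  have hmul0 : 0 ≤ᵐ[P] fun ω => (w n).1 ω * hD2.toLp _ ω := by
    filter_upwards [hD0, hD2.coeFn_toLp, (Lp.coeFn_nonneg _).2 (w n).2.1] with ω e1 e2 e3
    rw [e2]; exact mul_nonneg e3 e1
  have h2 : ENNReal.ofReal (∫ ω, (w n).1 ω * hD2.toLp _ ω ∂P) ≤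
      ENNReal.ofReal (∫ ω, D ω ∂(P.withDensity W)) := by
    rw [ofReal_integral_eq_lintegral_ofReal hmulint hmul0,
      ofReal_integral_eq_lintegral_ofReal (integrable_of_absolutelyContinuous hac D)
        (hac.ae_le hD0), lintegral_withDensity_eq_lintegral_mul₀ hWm
        (Lp.aestronglyMeasurable D).aemeasurable.ennreal_ofReal]
    refine lintegral_mono_ae ?_
    filter_upwards [hwle, hD2.coeFn_toLp, (Lp.coeFn_nonneg _).2 (w n).2.1] with ω e1 e2 e3
    rw [e2, ENNReal.ofReal_mul e3]
    refine mul_le_mul_left ((e1 n).trans ?_) _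
    exact add_le_add_right (ENNReal.sum_le_tsum _) _
  have h3 := (ENNReal.ofReal_le_ofReal_iff (integral_nonneg_of_ae (hac.ae_le hD0))).1 h2
  exact h1.trans_le h3

end Pricing

/-! ### Acceptance cones and the bipolar theorem -/

namespace Pricing

variable {Ω : Type*} {m : MeasurableSpace Ω} {P : Measure Ω}

/-- `C` is a convex cone of `L^∞` that is solid downwards and closed under a.s. limits of
increasing sequences. -/
structure IsAcceptanceCone (C : Set (Lp ℝ ∞ P)) : Prop where
  zero_mem : 0 ∈ C
  add_mem : ∀ X ∈ C, ∀ Y ∈ C, X + Y ∈ C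
  smul_mem : ∀ X ∈ C, ∀ l : ℝ, 0 ≤ l → l • X ∈ C
  mono : ∀ X ∈ C, ∀ Y, Y ≤ X → Y ∈ C
  closed : ∀ (X : ℕ → Lp ℝ ∞ P) (Y : Lp ℝ ∞ P), Monotone X → (∀ n, X n ∈ C) →
    (∀ᵐ ω ∂P, Tendsto (fun n => X n ω) atTop (𝓝 (Y ω))) → Y ∈ C

theorem tendsto_iInf_nat_add {a : ℕ → ℝ} {l : ℝ} (h : Tendsto a atTop (𝓝 l)) :
    Tendsto (fun n => ⨅ k, a (n + k)) atTop (𝓝 l) := by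
  rw [Metric.tendsto_atTop] at h ⊢
  intro ε hε
  obtain ⟨N, hN⟩ := h (ε / 2) (by positivity)
  refine ⟨N, fun n hn => ?_⟩
  have hk : ∀ k, |a (n + k) - l| < ε / 2 := fun k => hN (n + k) (by omega)
  have h1 : l - ε / 2 ≤ ⨅ k, a (n + k) := le_ciInf fun k => by
    have := (abs_lt.1 (hk k)).1; linarith
  have h2 : ⨅ k, a (n + k) ≤ a (n + 0) :=
    ciInf_le ⟨l - ε / 2, by rintro _ ⟨k, rfl⟩; have := (abs_lt.1 (hk k)).1; dsimp only; linarith⟩ 0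
  have h3 := (abs_lt.1 (hk 0)).2
  rw [Real.dist_eq, abs_lt]
  constructor <;> linarith

/-- The tail infima of the sequence lie below its terms, hence in C by solidity. They increase to
the limit, which reduces bounded convergence to the monotone case. -/
theorem IsAcceptanceCone.mem_of_tendsto {C : Set (Lp ℝ ∞ P)} (hC : IsAcceptanceCone C)
    {X : ℕ → Lp ℝ ∞ P} {Y : Lp ℝ ∞ P} {M : ℝ} (hX : ∀ n, X n ∈ C)
    (hM : ∀ n, ∀ᵐ ω ∂P, |X n ω| ≤ M)
    (hlim : ∀ᵐ ω ∂P, Tendsto (fun n => X n ω) atTop (𝓝 (Y ω))) : Y ∈ C := by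
  have hM' := ae_all_iff.2 hM
  have hbdd : ∀ᵐ ω ∂P, ∀ n, BddBelow (Set.range fun k => X (n + k) ω) := by
    filter_upwards [hM'] with ω h n
    exact ⟨-M, by rintro _ ⟨k, rfl⟩; exact (abs_le.1 (h (n + k))).1⟩
  let F : ℕ → Ω → ℝ := fun n ω => ⨅ k, X (n + k) ω
  have hF : ∀ n, MemLp (F n) ∞ P := by
    intro n
    refine memLp_top_of_bound (AEMeasurable.iInf fun k =>
      (Lp.aestronglyMeasurable (X (n + k))).aemeasurable).aestronglyMeasurable M ?_
    filter_upwards [hM', hbdd] with ω h h'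
    rw [Real.norm_eq_abs, abs_le]
    exact ⟨le_ciInf fun k => (abs_le.1 (h _)).1, (ciInf_le (h' n) 0).trans (abs_le.1 (h _)).2⟩
  have hco := ae_all_iff.2 fun n => (hF n).coeFn_toLp
  refine hC.closed (fun n => (hF n).toLp _) Y ?_ ?_ ?_
  · intro n k hnk
    rw [← Lp.coeFn_le]
    filter_upwards [hco, hbdd] with ω h h'
    rw [h, h]
    refine le_ciInf fun j => ?_
    obtain ⟨i, rfl⟩ := Nat.exists_eq_add_of_le hnk
    have := ciInf_le (h' n) (i + j)
    rwa [← add_assoc] at this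
  · intro n
    refine hC.mono _ (hX n) _ ?_
    rw [← Lp.coeFn_le]
    filter_upwards [hco, hbdd] with ω h h'
    rw [h]
    have h1 : ⨅ k, X (n + k) ω ≤ X (n + 0) ω := ciInf_le (h' n) 0
    rwa [add_zero] at h1
  · filter_upwards [hco, hlim] with ω h h'
    simp only [h]
    exact tendsto_iInf_nat_add (a := fun n => X n ω) h'

/-- This set contains 0 exactly when X is in C, so for X outside of C it can be charged by a finite
measure. -/
theorem IsAcceptanceCone.isFatouClosedConvex {C : Set (Lp ℝ ∞ P)} (hC : IsAcceptanceCone C)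
    (X : Lp ℝ ∞ P) : IsFatouClosedConvex {D | 0 ≤ D ∧ X - D ∈ C} where
  convex := by
    rintro D ⟨h1, h2⟩ E ⟨k1, k2⟩ a b ha hb hab
    refine ⟨?_, ?_⟩
    · rw [← Lp.coeFn_nonneg] at h1 k1 ⊢
      filter_upwards [h1, k1, Lp.coeFn_add (a • D) (b • E), Lp.coeFn_smul a D,
        Lp.coeFn_smul b E] with ω e1 e2 e3 e4 e5
      simp only [e3, e4, e5, Pi.add_apply, Pi.smul_apply, smul_eq_mul, Pi.zero_apply] at e1 e2 ⊢
      positivity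
    · have : X - (a • D + b • E) = a • (X - D) + b • (X - E) := by
        have hX : X = a • X + b • X := by rw [← add_smul, hab, one_smul]
        nth_rw 1 [hX]
        rw [smul_sub, smul_sub]
        abel
      rw [this]
      exact hC.add_mem _ (hC.smul_mem _ h2 a ha) _ (hC.smul_mem _ k2 b hb)
  nonneg := fun D hD => hD.1
  closed := by
    intro D D' N hD hN hlim
    have hnn : ∀ᵐ ω ∂P, ∀ n, 0 ≤ D n ω := ae_all_iff.2 fun n => (Lp.coeFn_nonneg _).2 (hD n).1
    have hsub : ∀ᵐ ω ∂P, ∀ n, (X - D n : Lp ℝ ∞ P) ω = X ω - D n ω :=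
      ae_all_iff.2 fun n => Lp.coeFn_sub _ _
    refine ⟨?_, hC.mem_of_tendsto (M := ‖X‖ + N) (fun n => (hD n).2) ?_ ?_⟩
    · rw [← Lp.coeFn_nonneg]
      filter_upwards [hnn, hlim] with ω h1 h2
      exact ge_of_tendsto' h2 h1
    · intro n
      filter_upwards [hsub, hnn, hN n, ae_abs_le_norm X] with ω h1 h2 h3 h4
      rw [h1]
      have := abs_le.1 h4
      rw [abs_le]
      constructor <;> linarith [h2 n]
    · filter_upwards [hsub, Lp.coeFn_sub X D', hlim] with ω h1 h2 h3
      simp only [h1, h2, Pi.sub_apply]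
      exact h3.const_sub _

/-- Bipolar theorem for acceptance cones: an `X` outside of the cone is separated from it by a
finite measure. -/
theorem IsAcceptanceCone.exists_measure_separating [IsProbabilityMeasure P] {C : Set (Lp ℝ ∞ P)}
    (hC : IsAcceptanceCone C) {X : Lp ℝ ∞ P} (hX : X ∉ C) :
    ∃ ν : Measure Ω, IsFiniteMeasure ν ∧ ν ≪ P ∧ (∀ Y ∈ C, ∫ ω, Y ω ∂ν ≤ 0) ∧
      0 < ∫ ω, X ω ∂ν := by
  obtain ⟨μ, hμ, hac, hsep⟩ := (hC.isFatouClosedConvex X).exists_measure (by simpa using hX)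
  have hmem : ∀ Y : Lp ℝ ∞ P, MemLp (Y : Ω → ℝ) 2 μ := fun Y =>
    memLp_of_absolutelyContinuous hac Y 2
  let C' : Set (Lp ℝ 2 μ) := {E | ∃ Y ∈ C, (hmem Y).toLp _ = E}
  have hconv : Convex ℝ C' := by
    rintro _ ⟨Y, hY, rfl⟩ _ ⟨Z, hZ, rfl⟩ a b ha hb -
    refine ⟨a • Y + b • Z, hC.add_mem _ (hC.smul_mem _ hY a ha) _ (hC.smul_mem _ hZ b hb), ?_⟩
    rw [← MemLp.toLp_const_smul, ← MemLp.toLp_const_smul, ← MemLp.toLp_add, MemLp.toLp_eq_toLp_iff]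
    filter_upwards [hac.ae_le (Lp.coeFn_add (a • Y) (b • Z)), hac.ae_le (Lp.coeFn_smul a Y),
      hac.ae_le (Lp.coeFn_smul b Z)] with ω e1 e2 e3
    rw [e1, Pi.add_apply, Pi.add_apply, e2, e3]
  have hone : MemLp (fun _ : Ω => (1 : ℝ)) 2 μ := memLp_const 1
  have hXcl : (hmem X).toLp _ ∉ closure C' := by
    intro hcl
    obtain ⟨_, ⟨Y, hY, rfl⟩, hd⟩ := Metric.mem_closure_iff.1 hcl (1 / (‖hone.toLp _‖ + 1))
      (by positivity)
    rw [dist_eq_norm, lt_div_iff₀ (by positivity)] at hd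
    -- X - (X - Y)⁺ ≤ Y lies in C, so (X - Y)⁺ has μ-integral above 1. By Cauchy–Schwarz, Y cannot
    -- be close to X in L²(μ).
    have hD := hsep ((X - Y) ⊔ 0) ⟨le_sup_right, hC.mono Y hY _ ?_⟩
    · have hle : ∫ ω, ((X - Y) ⊔ 0 : Lp ℝ ∞ P) ω ∂μ ≤
          inner ℝ |(hmem X).toLp _ - (hmem Y).toLp _| (hone.toLp _) := by
        rw [inner_L2_eq]
        refine integral_mono_ae (integrable_of_absolutelyContinuous hac _)
          ((Lp.memLp _).integrable_mul (Lp.memLp _)) ?_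
        filter_upwards [hac.ae_le (Lp.coeFn_sup (X - Y) 0), hac.ae_le (Lp.coeFn_sub X Y),
          hac.ae_le (Lp.coeFn_zero ℝ ∞ P), Lp.coeFn_abs ((hmem X).toLp _ - (hmem Y).toLp _),
          Lp.coeFn_sub ((hmem X).toLp _) ((hmem Y).toLp _), (hmem X).coeFn_toLp,
          (hmem Y).coeFn_toLp, hone.coeFn_toLp] with ω e1 e2 e3 e4 e5 e6 e7 e8
        rw [e1, Pi.sup_apply, e2, e3, e4, e5, Pi.sub_apply, Pi.sub_apply, e6, e7, e8, mul_one]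
        exact sup_le (le_abs_self _) (abs_nonneg _)
      have h1 := (hle.trans (real_inner_le_norm _ _))
      rw [norm_abs_eq_norm] at h1
      have h2 := norm_nonneg ((hmem X).toLp _ - (hmem Y).toLp _)
      nlinarith
    · have : X - Y ≤ (X - Y) ⊔ 0 := le_sup_left
      rw [sub_le_comm] at this
      exact this
  obtain ⟨f, u, hfC, hfX⟩ := geometric_hahn_banach_closed_point hconv.closure isClosed_closure hXcl
  set h : Lp ℝ 2 μ := (InnerProductSpace.toDual ℝ _).symm f with hh
  have hf : ∀ Y : Lp ℝ ∞ P, f ((hmem Y).toLp _) = ∫ ω, h ω * Y ω ∂μ := by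
    intro Y
    rw [← InnerProductSpace.toDual_symm_apply, ← hh, inner_L2_eq]
    refine integral_congr_ae ?_
    filter_upwards [(hmem Y).coeFn_toLp] with ω e
    rw [e]
  have hfC' : ∀ Y ∈ C, f ((hmem Y).toLp _) < u := fun Y hY => hfC _ (subset_closure ⟨Y, hY, rfl⟩)
  have hu : 0 < u := by
    have := hfC' 0 hC.zero_mem
    rw [hf, integral_congr_ae (g := fun _ => (0 : ℝ))] at this
    · simpa using this
    · filter_upwards [hac.ae_le (Lp.coeFn_zero ℝ ∞ P)] with ω e
      simp
  have hle : ∀ Y ∈ C, ∫ ω, h ω * Y ω ∂μ ≤ 0 := by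
    intro Y hY
    by_contra! hpos
    set c := ∫ ω, h ω * Y ω ∂μ with hc
    -- The multiple of Y by u / c takes the value u itself, against the strict bound on the cone.
    have h1 := hfC' _ (hC.smul_mem Y hY (u / c) (by positivity))
    rw [hf, integral_congr_ae (g := fun ω => (u / c) * (h ω * Y ω)), integral_const_mul, ← hc,
      div_mul_cancel₀ _ hpos.ne'] at h1
    · exact lt_irrefl _ h1
    · filter_upwards [hac.ae_le (Lp.coeFn_smul (u / c) Y)] with ω e
      rw [e, Pi.smul_apply, smul_eq_mul]; ring
  obtain ⟨h', hh'm, hh'⟩ := Lp.aestronglyMeasurable h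
  have hNm : MeasurableSet {ω | h' ω < 0} := measurableSet_lt hh'm.measurable measurable_const
  have hneg : 0 ≤ᵐ[μ] h := by
    by_cases hfinP : P {ω | h' ω < 0} = ∞
    · exact absurd hfinP (measure_ne_top _ _)
    -- C contains all nonpositive claims; testing with -1_{h < 0} shows that the density h is
    -- nonnegative.
    have hmemC : indicatorConstLp ∞ hNm hfinP (-1 : ℝ) ∈ C := by
      refine hC.mono 0 hC.zero_mem _ ?_
      rw [← Lp.coeFn_le]
      filter_upwards [Lp.coeFn_zero ℝ ∞ P, indicatorConstLp_coeFn (p := ∞) (hs := hNm)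
        (hμs := hfinP) (c := (-1 : ℝ))] with ω e1 e2
      rw [e1, e2]
      exact Set.indicator_nonpos (fun _ _ => by norm_num) ω
    have h1 := hle _ hmemC
    have h2 : ∫ ω, h ω * (indicatorConstLp ∞ hNm hfinP (-1 : ℝ) : Lp ℝ ∞ P) ω ∂μ =
        ∫ ω, max (-h' ω) 0 ∂μ := by
      refine integral_congr_ae ?_
      filter_upwards [hh', hac.ae_le (indicatorConstLp_coeFn (p := ∞) (hs := hNm)
        (hμs := hfinP) (c := (-1 : ℝ)))] with ω e1 e2
      rw [e1, e2]
      by_cases hω : h' ω < 0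
      · simp [Set.indicator, hω, hω.le]
      · simp [Set.indicator, hω, not_lt.1 hω]
    rw [h2] at h1
    have hint : Integrable (fun ω => max (-h' ω) 0) μ :=
      ((((Lp.memLp h).integrable (by norm_num)).congr hh').neg).pos_part
    have h3 := (integral_eq_zero_iff_of_nonneg (fun ω => le_max_right (-h' ω) 0) hint).1
      (le_antisymm h1 (integral_nonneg fun ω => le_max_right (-h' ω) 0))
    filter_upwards [hh', h3] with ω e1 e2
    rw [e1]
    simpa using e2
  have hν : IsFiniteMeasure (μ.withDensity fun ω => ENNReal.ofReal (h ω)) :=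
    isFiniteMeasure_withDensity_ofReal ((Lp.memLp h).integrable (by norm_num)).2
  have hνint : ∀ Y : Lp ℝ ∞ P, ∫ ω, Y ω ∂(μ.withDensity fun ω => ENNReal.ofReal (h ω)) =
      ∫ ω, h ω * Y ω ∂μ := by
    intro Y
    rw [integral_withDensity_eq_integral_toReal_smul₀
      (Lp.aestronglyMeasurable h).aemeasurable.ennreal_ofReal (by simp)]
    refine integral_congr_ae ?_
    filter_upwards [hneg] with ω e
    rw [ENNReal.toReal_ofReal e, smul_eq_mul]
  refine ⟨_, hν, (withDensity_absolutelyContinuous _ _).trans hac, fun Y hY => ?_, ?_⟩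
  · rw [hνint]; exact hle Y hY
  · rw [hνint, ← hf]; exact hu.trans hfX

end Pricing

/-! ### The Kreps–Yan theorem and equivalent pricing measures -/

namespace Pricing

variable {Ω : Type*} {m : MeasurableSpace Ω} {P : Measure Ω}

/-- The finite measures, absolutely continuous with respect to `P`, that are nonpositive on `C`. -/
def polarMeasures (C : Set (Lp ℝ ∞ P)) : Set (Measure Ω) :=
  {ν | IsFiniteMeasure ν ∧ ν ≪ P ∧ ∀ Y ∈ C, ∫ ω, Y ω ∂ν ≤ 0}

theorem add_mem_polarMeasures {C : Set (Lp ℝ ∞ P)} {μ ν : Measure Ω} (hμ : μ ∈ polarMeasures C)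
    (hν : ν ∈ polarMeasures C) : μ + ν ∈ polarMeasures C := by
  obtain ⟨hμ1, hμ2, hμ3⟩ := hμ
  obtain ⟨hν1, hν2, hν3⟩ := hν
  refine ⟨inferInstance, hμ2.add_left hν2, fun Y hY => ?_⟩
  rw [integral_add_measure (integrable_of_absolutelyContinuous hμ2 Y)
    (integrable_of_absolutelyContinuous hν2 Y)]
  exact add_nonpos (hμ3 Y hY) (hν3 Y hY)

theorem smul_mem_polarMeasures {C : Set (Lp ℝ ∞ P)} {ν : Measure Ω} {c : ℝ≥0∞} (hc : c ≠ ∞)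
    (hν : ν ∈ polarMeasures C) : c • ν ∈ polarMeasures C := by
  obtain ⟨hν1, hν2, hν3⟩ := hν
  refine ⟨Measure.smul_finite ν hc, hν2.smul_left c, fun Y hY => ?_⟩
  rw [integral_smul_measure]
  exact mul_nonpos_of_nonneg_of_nonpos ENNReal.toReal_nonneg (hν3 Y hY)

/-- A weighted sum with positive weights small enough for finite total mass still satisfies the
polar inequalities and dominates each term. -/
theorem exists_polarMeasure_dominating_seq {C : Set (Lp ℝ ∞ P)} {ν : ℕ → Measure Ω}
    (hν : ∀ n, ν n ∈ polarMeasures C) : ∃ μ ∈ polarMeasures C, ∀ n, ν n ≪ μ := by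
  have hfin : ∀ n, IsFiniteMeasure (ν n) := fun n => (hν n).1
  obtain ⟨δ, hδ, hsum⟩ := ENNReal.exists_pos_tsum_mul_lt_of_countable (ε := 1) one_ne_zero
    (fun n => ν n Set.univ) fun n => measure_ne_top _ _
  let μ : Measure Ω := Measure.sum fun n => (δ n : ℝ≥0∞) • ν n
  have hμfin : IsFiniteMeasure μ := by
    refine ⟨?_⟩
    rw [Measure.sum_apply _ MeasurableSet.univ]
    simp only [Measure.smul_apply, smul_eq_mul, mul_comm _ (ν _ _)]
    exact hsum.trans ENNReal.one_lt_top
  have hμP : μ ≪ P := Measure.absolutelyContinuous_sum_left fun n => (hν n).2.1.smul_left _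
  refine ⟨μ, ⟨hμfin, hμP, fun Y hY => ?_⟩, fun n => ?_⟩
  · rw [integral_sum_measure (integrable_of_absolutelyContinuous hμP Y)]
    exact tsum_nonpos fun n => (smul_mem_polarMeasures ENNReal.coe_ne_top (hν n)).2.2 Y hY
  · refine Measure.absolutelyContinuous_sum_right n ?_
    exact Measure.absolutelyContinuous_smul (by simpa using (hδ n).ne')

/-- The part of `P` that lives where `dν/dP` does not vanish is dominated by `ν`. -/
theorem restrict_rnDeriv_ne_zero_absolutelyContinuous [IsFiniteMeasure P] {ν : Measure Ω}
    [IsFiniteMeasure ν] (hν : ν ≪ P) : P.restrict {ω | ν.rnDeriv P ω ≠ 0} ≪ ν := by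
  have hm : MeasurableSet {ω | ν.rnDeriv P ω ≠ 0} :=
    (measurableSet_eq_fun (Measure.measurable_rnDeriv ν P) measurable_const).compl
  have h1 : P.restrict {ω | ν.rnDeriv P ω ≠ 0} ≪
      (P.restrict {ω | ν.rnDeriv P ω ≠ 0}).withDensity (ν.rnDeriv P) :=
    withDensity_absolutelyContinuous' (Measure.measurable_rnDeriv ν P).aemeasurable
      (ae_restrict_mem hm)
  rw [← restrict_withDensity hm, Measure.withDensity_rnDeriv_eq ν P hν] at h1
  exact h1.trans Measure.restrict_le_self.absolutelyContinuous

/-- Kreps–Yan theorem for acceptance cones. -/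
theorem IsAcceptanceCone.exists_polarMeasure_dominating [IsProbabilityMeasure P]
    {C : Set (Lp ℝ ∞ P)} (hC : IsAcceptanceCone C) (hC0 : ∀ X ∈ C, 0 ≤ X → X = 0) :
    ∃ ν ∈ polarMeasures C, P ≪ ν := by
  -- Exhaustion: the supremum of P(B), over the events B on which some polar measure dominates P, is
  -- attained by a countable union.
  let 𝒟 : Set (Set Ω) := {B | MeasurableSet B ∧ ∃ ν ∈ polarMeasures C, P.restrict B ≪ ν}
  have h𝒟 : ((fun B => P B) '' 𝒟).Nonempty := by
    refine ⟨_, ∅, ⟨MeasurableSet.empty, 0, ⟨inferInstance, ?_, fun Y _ => by simp⟩, ?_⟩, rfl⟩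
    · exact Measure.AbsolutelyContinuous.zero P
    · simp
  obtain ⟨u, -, hu, huD⟩ := exists_seq_tendsto_sSup h𝒟 (OrderTop.bddAbove _)
  choose B hB hBu using huD
  choose hBm ν hν hνB using hB
  obtain ⟨μ, hμ, hμν⟩ := exists_polarMeasure_dominating_seq hν
  have hUm : MeasurableSet (⋃ n, B n) := MeasurableSet.iUnion hBm
  have hUμ : P.restrict (⋃ n, B n) ≪ μ :=
    Measure.restrict_iUnion_le.absolutelyContinuous.trans
      (Measure.absolutelyContinuous_sum_left fun n => (hνB n).trans (hμν n))
  have hsup : sSup ((fun B => P B) '' 𝒟) ≤ P (⋃ n, B n) :=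
    le_of_tendsto' hu fun n => by rw [← hBu n]; exact measure_mono (Set.subset_iUnion B n)
  have hnull : P (⋃ n, B n)ᶜ = 0 := by
    by_contra hpos
    set N := (⋃ n, B n)ᶜ with hN
    -- If the uncovered set N had positive mass, 1_N would lie outside of C. A separating measure
    -- would then charge N, and the support of its density would enlarge the maximal event.
    have hXC : indicatorConstLp ∞ hUm.compl (measure_ne_top P N) (1 : ℝ) ∉ C := by
      intro hmem
      have h0 := hC0 _ hmem ?_
      · rw [Lp.eq_zero_iff_ae_eq_zero] at h0
        refine hpos (measure_eq_zero_iff_ae_notMem.2 ?_)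
        filter_upwards [h0, indicatorConstLp_coeFn (p := ∞) (hs := hUm.compl)
          (hμs := measure_ne_top P N) (c := (1 : ℝ))] with ω e1 e2 hω
        rw [e2, Set.indicator_of_mem hω] at e1
        exact one_ne_zero e1
      · rw [← Lp.coeFn_nonneg]
        filter_upwards [indicatorConstLp_coeFn (p := ∞) (hs := hUm.compl)
          (hμs := measure_ne_top P N) (c := (1 : ℝ))] with ω e
        rw [e]
        exact Set.indicator_nonneg (fun _ _ => zero_le_one) ω
    obtain ⟨ν', hν'fin, hν'P, hν'C, hν'pos⟩ := hC.exists_measure_separating hXC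
    have hν'N : ν' N ≠ 0 := by
      intro h0
      rw [integral_congr_ae (hν'P.ae_le indicatorConstLp_coeFn),
        integral_indicator_const _ hUm.compl, measureReal_def, h0] at hν'pos
      simp at hν'pos
    set E := {ω | ν'.rnDeriv P ω ≠ 0} with hE
    have hEm : MeasurableSet E :=
      (measurableSet_eq_fun (Measure.measurable_rnDeriv ν' P) measurable_const).compl
    have hmem : (⋃ n, B n) ∪ E ∈ 𝒟 := by
      refine ⟨hUm.union hEm, μ + ν', add_mem_polarMeasures hμ ⟨hν'fin, hν'P, hν'C⟩, ?_⟩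
      refine (Measure.restrict_union_le _ _).absolutelyContinuous.trans ?_
      exact Measure.AbsolutelyContinuous.add hUμ
        (restrict_rnDeriv_ne_zero_absolutelyContinuous hν'P)
    have hle : P ((⋃ n, B n) ∪ E) ≤ P (⋃ n, B n) :=
      (le_sSup (Set.mem_image_of_mem (fun B => P B) hmem)).trans hsup
    have hdiff : P (N ∩ E) = 0 := by
      have h1 : (⋃ n, B n) ∪ E = (⋃ n, B n) ∪ (N ∩ E) := by
        ext ω; simp only [hN, Set.mem_union, Set.mem_inter_iff, Set.mem_compl_iff]; tauto
      rw [h1, measure_union (Set.disjoint_left.2 fun ω h2 h3 => h3.1 h2) (hUm.compl.inter hEm)] at hle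
      exact le_zero_iff.1 ((ENNReal.add_le_add_iff_left (measure_ne_top P (⋃ n, B n))).1
        (by rwa [add_zero]))
    refine hν'N ?_
    have h2 : ν' (N ∩ E) = 0 := hν'P hdiff
    have h3 : ν' Eᶜ = 0 := by
      have : Eᶜ = {ω | ν'.rnDeriv P ω = 0} := by ext ω; simp [hE]
      rw [← Measure.withDensity_rnDeriv_eq ν' P hν'P, withDensity_apply _ hEm.compl,
        setLIntegral_congr_fun hEm.compl (g := fun _ => 0)]
      · simp
      · intro ω hω
        rw [this] at hω
        exact hω
    refine measure_mono_null (fun ω hω => ?_) (measure_union_null h2 h3)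
    by_cases h : ω ∈ E
    · exact Or.inl ⟨hω, h⟩
    · exact Or.inr h
  refine ⟨μ, hμ, fun A hA => ?_⟩
  have h1 := hUμ hA
  rw [Measure.restrict_apply₀' hUm.nullMeasurableSet] at h1
  refine measure_mono_null (fun ω hω => ?_) (measure_union_null h1 hnull)
  by_cases h : ω ∈ ⋃ n, B n
  · exact Or.inl ⟨hω, h⟩
  · exact Or.inr h

/-- The probability measures equivalent to `P` under which all elements of `C` have nonpositive
expectation. -/
def pricingMeasures (C : Set (Lp ℝ ∞ P)) : Set (Measure Ω) :=
  {Q | Q ∈ equivProb P ∧ ∀ Y ∈ C, ∫ ω, Y ω ∂Q ≤ 0}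

theorem normalize_mem_pricingMeasures [NeZero P] {C : Set (Lp ℝ ∞ P)} {ν : Measure Ω}
    (hν : ν ∈ polarMeasures C) (hPν : P ≪ ν) :
    (ν Set.univ)⁻¹ • ν ∈ pricingMeasures C := by
  have := hν.1
  have hne : ν Set.univ ≠ 0 := fun h => (NeZero.ne P)
    (Measure.measure_univ_eq_zero.1 (hPν h))
  have hinv : (ν Set.univ)⁻¹ ≠ ∞ := ENNReal.inv_ne_top.2 hne
  obtain ⟨-, h2, h3⟩ := smul_mem_polarMeasures hinv hν
  refine ⟨⟨⟨?_⟩, h2, hPν.trans (Measure.absolutelyContinuous_smul ?_)⟩, h3⟩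
  · rw [Measure.smul_apply, smul_eq_mul, ENNReal.inv_mul_cancel hne (measure_ne_top _ _)]
  · exact ENNReal.inv_ne_zero.2 (measure_ne_top _ _)

theorem IsAcceptanceCone.pricingMeasures_nonempty [IsProbabilityMeasure P]
    {C : Set (Lp ℝ ∞ P)} (hC : IsAcceptanceCone C) (hC0 : ∀ X ∈ C, 0 ≤ X → X = 0) :
    (pricingMeasures C).Nonempty := by
  obtain ⟨ν, hν, hPν⟩ := hC.exists_polarMeasure_dominating hC0
  exact ⟨_, normalize_mem_pricingMeasures hν hPν⟩

/-- A separating measure ν need not be equivalent to P. Adding a large multiple of it to an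
equivalent polar measure keeps the integral of X positive and restores equivalence. -/
theorem IsAcceptanceCone.mem_of_forall_pricingMeasures [IsProbabilityMeasure P]
    {C : Set (Lp ℝ ∞ P)} (hC : IsAcceptanceCone C) (hC0 : ∀ X ∈ C, 0 ≤ X → X = 0)
    {X : Lp ℝ ∞ P} (hX : ∀ Q ∈ pricingMeasures C, ∫ ω, X ω ∂Q ≤ 0) : X ∈ C := by
  by_contra hXC
  obtain ⟨μ, hμ, hPμ⟩ := hC.exists_polarMeasure_dominating hC0
  obtain ⟨ν, hνfin, hνP, hνC, hνX⟩ := hC.exists_measure_separating hXC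
  have hμfin := hμ.1
  -- a large multiple of `ν` outweighs the contribution of `μ`
  obtain ⟨n, hn⟩ := exists_nat_gt (-(∫ ω, X ω ∂μ) / ∫ ω, X ω ∂ν)
  rw [div_lt_iff₀ hνX] at hn
  have hnν := smul_mem_polarMeasures (ENNReal.natCast_ne_top n) ⟨hνfin, hνP, hνC⟩
  have hnfin := hnν.1
  have hsum := add_mem_polarMeasures hμ hnν
  have hPsum : P ≪ μ + (n : ℝ≥0∞) • ν := hPμ.trans
    (Measure.le_add_right le_rfl).absolutelyContinuous
  have h1 := hX _ (normalize_mem_pricingMeasures hsum hPsum)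
  have hsumfin := hsum.1
  have hne : (μ + (n : ℝ≥0∞) • ν) Set.univ ≠ 0 := fun h => (NeZero.ne P)
    (Measure.measure_univ_eq_zero.1 (hPsum h))
  rw [integral_smul_measure, integral_add_measure (integrable_of_absolutelyContinuous hμ.2.1 X)
    (integrable_of_absolutelyContinuous hnν.2.1 X), integral_smul_measure, smul_eq_mul,
    smul_eq_mul, ENNReal.toReal_natCast] at h1
  have h2 : 0 < ((μ + (n : ℝ≥0∞) • ν) Set.univ)⁻¹.toReal :=
    ENNReal.toReal_pos (ENNReal.inv_ne_zero.2 (measure_ne_top _ _)) (ENNReal.inv_ne_top.2 hne)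
  have h3 : 0 < ∫ ω, X ω ∂μ + n * ∫ ω, X ω ∂ν := by linarith
  exact absurd h1 (not_le.2 (mul_pos h2 h3))

end Pricing

namespace Pricing

/-! ### Essential suprema as countable suprema -/

section EssSup

variable {Ω : Type*} {m : MeasurableSpace Ω} {P : Measure Ω}

theorem ae_le_iSup_of_ae_le {f : ℕ → Ω → ℝ} {M : ℝ} (hf : ∀ n, ∀ᵐ ω ∂P, f n ω ≤ M) :
    ∀ᵐ ω ∂P, ∀ n, f n ω ≤ ⨆ k, f k ω := by
  filter_upwards [ae_all_iff.2 hf] with ω h n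
  exact le_ciSup (f := fun k => f k ω) ⟨M, by rintro _ ⟨k, rfl⟩; exact h k⟩ n

theorem ae_abs_iSup_le {f : ℕ → Ω → ℝ} {M : ℝ} (hf : ∀ n, ∀ᵐ ω ∂P, |f n ω| ≤ M) :
    ∀ᵐ ω ∂P, |⨆ k, f k ω| ≤ M := by
  filter_upwards [ae_all_iff.2 hf] with ω h
  rw [abs_le]
  exact ⟨(abs_le.1 (h 0)).1.trans (le_ciSup (f := fun k => f k ω)
    ⟨M, by rintro _ ⟨k, rfl⟩; exact (abs_le.1 (h k)).2⟩ 0), ciSup_le fun k => (abs_le.1 (h k)).2⟩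

/-- The essential supremum of a uniformly bounded family is the supremum of a countable
subfamily. -/
theorem exists_seq_iSup_isEssSup [IsFiniteMeasure P] {𝒢 : Set (Ω → ℝ)} (hne : 𝒢.Nonempty)
    (hmeas : ∀ f ∈ 𝒢, AEMeasurable f P) {M : ℝ} (hM : ∀ f ∈ 𝒢, ∀ᵐ ω ∂P, |f ω| ≤ M) :
    ∃ f : ℕ → Ω → ℝ, (∀ n, f n ∈ 𝒢) ∧ IsEssSup P 𝒢 fun ω => ⨆ n, f n ω := by
  let G : (ℕ → 𝒢) → Ω → ℝ := fun s ω => ⨆ n, (s n : Ω → ℝ) ω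
  have hGle : ∀ s : ℕ → 𝒢, ∀ᵐ ω ∂P, ∀ n, (s n : Ω → ℝ) ω ≤ G s ω := fun s =>
    ae_le_iSup_of_ae_le fun n => (hM _ (s n).2).mono fun ω h => (le_abs_self _).trans h
  have hGM : ∀ s : ℕ → 𝒢, ∀ᵐ ω ∂P, |G s ω| ≤ M := fun s => ae_abs_iSup_le fun n => hM _ (s n).2
  have hGint : ∀ s : ℕ → 𝒢, Integrable (G s) P := fun s =>
    Integrable.of_bound (AEMeasurable.iSup fun n => hmeas _ (s n).2).aestronglyMeasurable M (hGM s)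
  obtain ⟨g₀, hg₀⟩ := hne
  have hrne : (Set.range fun s => ∫ ω, G s ω ∂P).Nonempty := ⟨_, fun _ => ⟨g₀, hg₀⟩, rfl⟩
  have hrbdd : BddAbove (Set.range fun s => ∫ ω, G s ω ∂P) := by
    refine ⟨∫ _, M ∂P, ?_⟩
    rintro _ ⟨s, rfl⟩
    exact integral_mono_ae (hGint s) (integrable_const M)
      ((hGM s).mono fun ω h => (le_abs_self _).trans h)
  obtain ⟨u, -, hu, huD⟩ := exists_seq_tendsto_sSup hrne hrbdd
  choose s hs using huD
  -- Enumerating a maximizing sequence of countable families as a single one attains the maximal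
  -- integral. Prepending any further g cannot raise it, so g lies below the supremum a.e.
  let s' : ℕ → 𝒢 := fun n => s n.unpair.1 n.unpair.2
  have hs' : sSup (Set.range fun s => ∫ ω, G s ω ∂P) ≤ ∫ ω, G s' ω ∂P := by
    refine le_of_tendsto' hu fun n => ?_
    rw [← hs n]
    refine integral_mono_ae (hGint _) (hGint _) ?_
    filter_upwards [hGle s'] with ω h
    refine ciSup_le fun k => ?_
    have := h (Nat.pair n k)
    simpa [s', Nat.unpair_pair] using this
  refine ⟨fun n => s' n, fun n => (s' n).2, fun g hg => ?_, fun Z _ hZ => ?_⟩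
  · let s'' : ℕ → 𝒢 := fun n => Nat.casesOn n ⟨g, hg⟩ s'
    have hle : G s' ≤ᵐ[P] G s'' := by
      filter_upwards [hGle s''] with ω h
      exact ciSup_le fun k => h (k + 1)
    have heq : G s' =ᵐ[P] G s'' := by
      refine (integral_eq_iff_of_ae_le (hGint _) (hGint _) hle).1 ?_
      exact le_antisymm (integral_mono_ae (hGint _) (hGint _) hle)
        ((le_csSup hrbdd ⟨s'', rfl⟩).trans hs')
    filter_upwards [hGle s'', heq] with ω h1 h2
    change g ω ≤ G s' ω
    rw [h2]
    exact h1 0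
  · filter_upwards [ae_all_iff.2 fun n => hZ _ (s' n).2] with ω h
    exact ciSup_le h

theorem IsEssSup.ae_eq {𝒢 : Set (Ω → ℝ)} {Y Z : Ω → ℝ} (hY : IsEssSup P 𝒢 Y)
    (hZ : IsEssSup P 𝒢 Z) (hYm : AEMeasurable Y P) (hZm : AEMeasurable Z P) : Y =ᵐ[P] Z := by
  filter_upwards [hY.2 Z hZm hZ.1, hZ.2 Y hYm hY.1] with ω h1 h2
  exact le_antisymm h1 h2

theorem IsEssSup.congr {𝒢 : Set (Ω → ℝ)} {Y Z : Ω → ℝ} (hY : IsEssSup P 𝒢 Y) (h : Y =ᵐ[P] Z) :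
    IsEssSup P 𝒢 Z :=
  ⟨fun f hf => (hY.1 f hf).trans h.le, fun W hW hW' => h.symm.le.trans (hY.2 W hW hW')⟩

end EssSup

/-! ### Conditional expectations and pasting of measures -/

section CondExp

variable {Ω : Type*} {mσ m : MeasurableSpace Ω} {P Q Q' : Measure Ω}

theorem ae_le_eLpNorm_top_toReal {f : Ω → ℝ} (hf : MemLp f ∞ P) :
    ∀ᵐ ω ∂P, |f ω| ≤ (eLpNorm f ∞ P).toReal := by
  filter_upwards [hf.coeFn_toLp, ae_abs_le_norm (hf.toLp f)] with ω h1 h2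
  rwa [h1, Lp.norm_toLp] at h2

theorem memLp_top_of_abs_le {f : Ω → ℝ} (hf : AEStronglyMeasurable f P) {M : ℝ}
    (hM : ∀ᵐ ω ∂P, |f ω| ≤ M) : MemLp f ∞ P := memLp_top_of_bound hf M hM

theorem memLp_top_mono_ac {f : Ω → ℝ} (hf : MemLp f ∞ P) (h : Q ≪ P) : MemLp f ∞ Q :=
  memLp_top_of_abs_le (hf.1.mono_ac h) (h.ae_le (ae_le_eLpNorm_top_toReal hf))

theorem integrable_of_memLp_top [IsFiniteMeasure Q] {f : Ω → ℝ} (hf : MemLp f ∞ P) (h : Q ≪ P) :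
    Integrable f Q := (memLp_top_mono_ac hf h).integrable le_top

theorem ae_abs_condExp_le (hQP : Q ≪ P) (hPQ : P ≪ Q) {f : Ω → ℝ} {M : ℝ}
    (hM : ∀ᵐ ω ∂P, |f ω| ≤ M) : ∀ᵐ ω ∂P, |(Q[f | mσ]) ω| ≤ M :=
  hPQ.ae_le (ae_bdd_abs_condExp_of_ae_bdd_abs (R := M) (hQP.ae_le hM))

theorem memLp_top_condExp (hm : mσ ≤ m) (hQP : Q ≪ P) (hPQ : P ≪ Q) {f : Ω → ℝ}
    (hf : MemLp f ∞ P) : MemLp (Q[f | mσ]) ∞ P :=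
  memLp_top_of_abs_le (stronglyMeasurable_condExp.mono hm).aestronglyMeasurable
    (ae_abs_condExp_le hQP hPQ (ae_le_eLpNorm_top_toReal hf))

/-- Upper bounds of conditional expectations are preserved under dominated limits. -/
theorem condExp_le_of_tendsto [IsFiniteMeasure Q] (hm : mσ ≤ m) {f : ℕ → Ω → ℝ} {g L : Ω → ℝ}
    {M : ℝ} (hf : ∀ n, AEStronglyMeasurable (f n) Q) (hM : ∀ n, ∀ᵐ ω ∂Q, |f n ω| ≤ M)
    (hlim : ∀ᵐ ω ∂Q, Tendsto (fun n => f n ω) atTop (𝓝 (g ω)))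
    (hL : ∀ n, Q[f n | mσ] ≤ᵐ[Q] L) : Q[g | mσ] ≤ᵐ[Q] L := by
  have h1 := tendsto_condExpL1_of_dominated_convergence hm (fun _ => M) hf (integrable_const M)
    hM hlim
  -- The conditional expectations converge in L¹; an a.e. convergent subsequence suffices for an
  -- upper bound.
  obtain ⟨ns, -, hns⟩ := (tendstoInMeasure_of_tendsto_Lp h1).exists_seq_tendsto_ae
  filter_upwards [hns, condExp_ae_eq_condExpL1 hm g, ae_all_iff.2 hL,
    ae_all_iff.2 fun n => condExp_ae_eq_condExpL1 hm (f n)] with ω e1 e2 e3 e4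
  rw [e2]
  refine le_of_tendsto' e1 fun n => ?_
  rw [← e4]
  exact e3 _

/-- The measure that follows `Q` on `mσ` and `Q'` conditionally on `mσ`. -/
theorem exists_pasting (hm : mσ ≤ m) (hQ : Q ∈ equivProb P) (hR : Q' ∈ equivProb P) :
    ∃ S ∈ equivProb P, ∀ f : Ω → ℝ, MemLp f ∞ P → ∫ ω, f ω ∂S = ∫ ω, (Q'[f | mσ]) ω ∂Q := by
  obtain ⟨hQ1, hQP, hPQ⟩ := hQ
  obtain ⟨hR1, hRP, hPR⟩ := hR
  have hQR : Q.trim hm ≪ Q'.trim hm := (hQP.trans hPR).trim hm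
  have hRQ : Q'.trim hm ≪ Q.trim hm := (hRP.trans hPQ).trim hm
  -- The density of Q with respect to Q' on the sub-σ-algebra: reweighting Q' by it changes the law
  -- there to Q and leaves conditional expectations given it unchanged.
  let h : Ω → ℝ≥0∞ := (Q.trim hm).rnDeriv (Q'.trim hm)
  have hhm : Measurable[mσ] h := Measure.measurable_rnDeriv _ _
  have hhm' : Measurable h := hhm.mono hm le_rfl
  have hlint : ∫⁻ ω, h ω ∂Q' = 1 := by
    rw [← lintegral_trim hm hhm, Measure.lintegral_rnDeriv hQR, trim_measurableSet_eq hm MeasurableSet.univ]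
    exact measure_univ
  have hhfin : ∀ᵐ ω ∂Q', h ω < ∞ := ae_lt_top hhm' (by rw [hlint]; exact ENNReal.one_ne_top)
  have hhpos : ∀ᵐ ω ∂Q', h ω ≠ 0 := by
    refine ae_of_ae_trim hm ?_
    filter_upwards [Measure.rnDeriv_pos' hRQ] with ω e using e.ne'
  have hhint : Integrable (fun ω => (h ω).toReal) Q' :=
    integrable_toReal_of_lintegral_ne_top hhm'.aemeasurable (by rw [hlint]; exact ENNReal.one_ne_top)
  have hhsm : StronglyMeasurable[mσ] fun ω => (h ω).toReal :=
    (hhm.ennreal_toReal).stronglyMeasurable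
  refine ⟨Q'.withDensity h, ⟨⟨?_⟩, (withDensity_absolutelyContinuous _ _).trans hRP,
    hPR.trans (withDensity_absolutelyContinuous' hhm'.aemeasurable hhpos)⟩, fun f hf => ?_⟩
  · rw [withDensity_apply _ MeasurableSet.univ, Measure.restrict_univ, hlint]
  have hmulint : Integrable (fun ω => (h ω).toReal * f ω) Q' :=
    hhint.mul_bdd (hf.1.mono_ac hRP) (hRP.ae_le (ae_le_eLpNorm_top_toReal hf))
  have hcm : StronglyMeasurable[mσ] (Q'[f | mσ]) := stronglyMeasurable_condExp
  calc ∫ ω, f ω ∂(Q'.withDensity h) = ∫ ω, (h ω).toReal * f ω ∂Q' := by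
        rw [integral_withDensity_eq_integral_toReal_smul hhm' hhfin]; rfl
    _ = ∫ ω, (Q'[fun ω => (h ω).toReal * f ω | mσ]) ω ∂Q' := (integral_condExp hm).symm
    _ = ∫ ω, (h ω).toReal * (Q'[f | mσ]) ω ∂Q' := by
        refine integral_congr_ae ?_
        exact condExp_mul_of_stronglyMeasurable_left hhsm hmulint (integrable_of_memLp_top hf hRP)
    _ = ∫ ω, (h ω).toReal * (Q'[f | mσ]) ω ∂(Q'.trim hm) := integral_trim hm (hhsm.mul hcm)
    _ = ∫ ω, (Q'[f | mσ]) ω ∂(Q.trim hm) := integral_rnDeriv_smul hQR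
    _ = ∫ ω, (Q'[f | mσ]) ω ∂Q := (integral_trim hm hcm).symm

theorem eq_of_forall_real_eq [IsFiniteMeasure Q] [IsFiniteMeasure Q']
    (h : ∀ A, MeasurableSet A → Q.real A = Q'.real A) : Q = Q' := by
  refine Measure.ext fun A hA => ?_
  have := h A hA
  rwa [measureReal_def, measureReal_def, ENNReal.toReal_eq_toReal_iff' (measure_ne_top _ _)
    (measure_ne_top _ _)] at this

theorem memLp_top_indicator_one [IsFiniteMeasure P] {A : Set Ω} (hA : MeasurableSet A) :
    MemLp (A.indicator fun _ => (1 : ℝ)) ∞ P := (memLp_const 1).indicator hA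

/-- A pasting is determined by its values on events. -/
theorem integral_eq_of_pasting [IsFiniteMeasure P] (hm : mσ ≤ m) (hQ : Q ∈ equivProb P)
    (hR : Q' ∈ equivProb P) {S : Measure Ω} (hSP : S ∈ equivProb P)
    (hS : ∀ A : Set Ω, MeasurableSet A →
      S.real A = ∫ ω, (Q'[A.indicator (fun _ => (1 : ℝ)) | mσ]) ω ∂Q)
    {f : Ω → ℝ} (hf : MemLp f ∞ P) : ∫ ω, f ω ∂S = ∫ ω, (Q'[f | mσ]) ω ∂Q := by
  obtain ⟨S', hS'P, hS'⟩ := exists_pasting hm hQ hR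
  have h1 := hSP.1
  have h2 := hS'P.1
  have : S = S' := by
    refine eq_of_forall_real_eq fun A hA => ?_
    rw [hS A hA, ← hS' _ (memLp_top_indicator_one hA), integral_indicator_const _ hA, smul_eq_mul,
      mul_one]
  rw [this, hS' f hf]

/-- Comparison of two functions that are measurable for a sub-σ-algebra, through their integrals
over the sets of that σ-algebra. -/
theorem ae_le_of_forall_setIntegral_le_sub [IsFiniteMeasure Q] (hm : mσ ≤ m) {f g : Ω → ℝ} (hf : StronglyMeasurable[mσ] f)
    (hg : StronglyMeasurable[mσ] g) (hfi : Integrable f Q) (hgi : Integrable g Q)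
    (h : ∀ A, MeasurableSet[mσ] A → ∫ ω in A, f ω ∂Q ≤ ∫ ω in A, g ω ∂Q) : f ≤ᵐ[Q] g := by
  refine ae_le_of_ae_le_trim (hm := hm) (f₁ := f) (f₂ := g) ?_
  refine ae_le_of_forall_setIntegral_le (hfi.trim hm hf) (hgi.trim hm hg) fun A hA _ => ?_
  rw [← setIntegral_trim hm hf hA, ← setIntegral_trim hm hg hA]
  exact h A hA

end CondExp

end Pricing

/-! ### Pricing procedures through the prices of terminal claims -/

namespace Pricing

variable {Ω : Type*} {m : MeasurableSpace Ω} {𝓕 : Filtration ℝ≥0 m} {P : Measure Ω}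

theorem StoppingTime.sigma_le (τ : StoppingTime 𝓕) : τ.sigma ≤ m := fun _ hs => hs.1

theorem StoppingTime.le_sigma_infty : m ≤ (StoppingTime.infty 𝓕).sigma := fun s hs =>
  ⟨hs, fun t => by
    rw [show {ω : Ω | (StoppingTime.infty 𝓕).1 ω ≤ (t : WithTop ℝ≥0)} = ∅ from
      Set.eq_empty_of_forall_notMem fun ω h => not_le.2 (WithTop.coe_lt_top t) h]
    simp⟩

theorem LInf.le_iff {τ : StoppingTime 𝓕} {X Y : LInf P τ} :
    X ≤ Y ↔ ((X : Lp ℝ ∞ P) : Ω → ℝ) ≤ᵐ[P] (Y : Lp ℝ ∞ P) :=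
  (Lp.coeFn_le (X : Lp ℝ ∞ P) (Y : Lp ℝ ∞ P)).symm

theorem LInf.ext_ae {τ : StoppingTime 𝓕} {X Y : LInf P τ}
    (h : ((X : Lp ℝ ∞ P) : Ω → ℝ) =ᵐ[P] (Y : Lp ℝ ∞ P)) : X = Y := Subtype.ext (Lp.ext h)

theorem LInf.coe_add_ae {τ : StoppingTime 𝓕} (X Y : LInf P τ) :
    (((X + Y : LInf P τ) : Lp ℝ ∞ P) : Ω → ℝ) =ᵐ[P]
      ((X : Lp ℝ ∞ P) : Ω → ℝ) + ((Y : Lp ℝ ∞ P) : Ω → ℝ) :=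
  Lp.coeFn_add (X : Lp ℝ ∞ P) (Y : Lp ℝ ∞ P)

theorem LInf.coe_smul_ae {τ : StoppingTime 𝓕} (c : ℝ) (X : LInf P τ) :
    (((c • X : LInf P τ) : Lp ℝ ∞ P) : Ω → ℝ) =ᵐ[P] c • ((X : Lp ℝ ∞ P) : Ω → ℝ) :=
  Lp.coeFn_smul c (X : Lp ℝ ∞ P)

theorem LInf.coe_zero_ae (τ : StoppingTime 𝓕) :
    (((0 : LInf P τ) : Lp ℝ ∞ P) : Ω → ℝ) =ᵐ[P] 0 := Lp.coeFn_zero ℝ ∞ P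

theorem LInf.memLp {τ : StoppingTime 𝓕} (X : LInf P τ) :
    MemLp ((X : Lp ℝ ∞ P) : Ω → ℝ) ∞ P := Lp.memLp _

theorem LInf.aestronglyMeasurable {τ : StoppingTime 𝓕} (X : LInf P τ) :
    AEStronglyMeasurable[τ.sigma] ((X : Lp ℝ ∞ P) : Ω → ℝ) P :=
  mem_lpMeas_iff_aestronglyMeasurable.1 X.2

theorem exists_LInf {τ : StoppingTime 𝓕} {f : Ω → ℝ} (hf : AEStronglyMeasurable[τ.sigma] f P)
    (hf' : MemLp f ∞ P) : ∃ X : LInf P τ, ((X : Lp ℝ ∞ P) : Ω → ℝ) =ᵐ[P] f :=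
  ⟨⟨hf'.toLp f, mem_lpMeas_iff_aestronglyMeasurable.2 (hf.congr hf'.coeFn_toLp.symm)⟩,
    hf'.coeFn_toLp⟩

/-- `L^∞(P)` is `L^∞(F_∞)`. -/
noncomputable def ofLp (𝓕 : Filtration ℝ≥0 m) (X : Lp ℝ ∞ P) : LInf P (StoppingTime.infty 𝓕) :=
  ⟨X, mem_lpMeas_iff_aestronglyMeasurable.2
    ((Lp.aestronglyMeasurable X).mono StoppingTime.le_sigma_infty)⟩

/-- `Π_{σ,∞}` as a map from `L^∞(P)` to itself. -/
noncomputable def price (Φ : PriceFamily 𝓕 P) (σ : StoppingTime 𝓕) (X : Lp ℝ ∞ P) : Lp ℝ ∞ P :=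
  (Φ.toInfty σ (ofLp 𝓕 X) : Lp ℝ ∞ P)

theorem aestronglyMeasurable_price (Φ : PriceFamily 𝓕 P) (σ : StoppingTime 𝓕) (X : Lp ℝ ∞ P) :
    AEStronglyMeasurable[σ.sigma] (price Φ σ X : Ω → ℝ) P :=
  LInf.aestronglyMeasurable (Φ.toInfty σ (ofLp 𝓕 X))

section Procedure

variable {Φ : PriceFamily 𝓕 P}

theorem IsDynamicPricingProcedure.price_mono (hΦ : IsDynamicPricingProcedure Φ)
    (σ : StoppingTime 𝓕) {X Y : Lp ℝ ∞ P} (h : X ≤ Y) : price Φ σ X ≤ price Φ σ Y :=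
  hΦ.monotone σ _ σ.le_infty (ofLp 𝓕 X) (ofLp 𝓕 Y) h

theorem IsDynamicPricingProcedure.price_zero (hΦ : IsDynamicPricingProcedure Φ)
    (σ : StoppingTime 𝓕) : price Φ σ 0 = 0 :=
  congrArg Subtype.val (hΦ.normalized σ _ σ.le_infty)

theorem IsDynamicPricingProcedure.price_add (hΦ : IsDynamicPricingProcedure Φ)
    (σ : StoppingTime 𝓕) (X : Lp ℝ ∞ P) (Z : LInf P σ) :
    price Φ σ (X + (Z : Lp ℝ ∞ P)) = price Φ σ X + (Z : Lp ℝ ∞ P) :=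
  congrArg Subtype.val (hΦ.translation σ _ σ.le_infty Z (ofLp 𝓕 X))

/-- Normalization and translation invariance make Π_{τ,∞} the identity on L^∞(F_τ); time consistency
then gives Π_{σ,τ} = Π_{σ,∞} there. It suffices to study Π_{σ,∞}. -/
theorem IsTCPP.eq_price (hΦ : IsTCPP Φ) (σ τ : StoppingTime 𝓕) (h : σ ≤ τ) (X : LInf P τ) :
    (Φ σ τ h X : Lp ℝ ∞ P) = price Φ σ (X : Lp ℝ ∞ P) := by
  have h1 : Φ τ _ τ.le_infty (LInf.incl P τ.le_infty X) = X := by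
    have := hΦ.isDynamicPricingProcedure.translation τ _ τ.le_infty X 0
    rwa [zero_add, hΦ.isDynamicPricingProcedure.normalized, zero_add] at this
  have h2 := hΦ.isTimeConsistent σ τ _ h τ.le_infty (LInf.incl P τ.le_infty X)
  rw [h1] at h2
  exact congrArg Subtype.val h2

theorem IsTCPP.price_price (hΦ : IsTCPP Φ) (ν σ : StoppingTime 𝓕) (h : ν ≤ σ) (X : Lp ℝ ∞ P) :
    price Φ ν (price Φ σ X) = price Φ ν X := by
  have h1 := hΦ.isTimeConsistent ν σ _ h σ.le_infty (ofLp 𝓕 X)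
  have h2 := congrArg Subtype.val h1
  rw [hΦ.eq_price] at h2
  exact h2

/-- Adding to Y an F_σ-measurable constant multiple of 1_{Aᶜ}, large enough to dominate X - Y, makes
the comparison global. Translation invariance carries this term through the price, and it vanishes
on A. -/
theorem IsDynamicPricingProcedure.price_le_on (hΦ : IsDynamicPricingProcedure Φ)
    [IsFiniteMeasure P] (σ : StoppingTime 𝓕) {A : Set Ω} (hA : MeasurableSet[σ.sigma] A)
    {X Y : Lp ℝ ∞ P} (h : ∀ᵐ ω ∂P, ω ∈ A → X ω ≤ Y ω) :
    ∀ᵐ ω ∂P, ω ∈ A → price Φ σ X ω ≤ price Φ σ Y ω := by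
  have hZm : StronglyMeasurable[σ.sigma] (Aᶜ.indicator fun _ : Ω => ‖X‖ + ‖Y‖) :=
    stronglyMeasurable_const.indicator hA.compl
  obtain ⟨Z, hZ⟩ := exists_LInf (P := P) (τ := σ) hZm.aestronglyMeasurable
    ((memLp_const (‖X‖ + ‖Y‖)).indicator hA.compl.1)
  have hle : X ≤ Y + (Z : Lp ℝ ∞ P) := by
    rw [← Lp.coeFn_le]
    filter_upwards [h, hZ, Lp.coeFn_add Y (Z : Lp ℝ ∞ P), ae_abs_le_norm X, ae_abs_le_norm Y]
      with ω e1 e2 e3 e4 e5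
    rw [e3, Pi.add_apply, e2]
    by_cases hω : ω ∈ A
    · simpa [Set.indicator, hω] using e1 hω
    · have h1 := le_of_abs_le e4
      have h2 := neg_le_of_abs_le e5
      simp only [Set.indicator, Set.mem_compl_iff, hω, not_false_eq_true, if_true]
      linarith
  have h1 := hΦ.price_mono σ hle
  rw [hΦ.price_add, ← Lp.coeFn_le] at h1
  filter_upwards [h1, hZ, Lp.coeFn_add (price Φ σ Y) (Z : Lp ℝ ∞ P)] with ω e1 e2 e3 hω
  rw [e3, Pi.add_apply, e2] at e1
  simpa [Set.indicator, hω] using e1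

/-- Locality together with translation invariance. -/
theorem IsDynamicPricingProcedure.price_indicator_sub (hΦ : IsDynamicPricingProcedure Φ)
    [IsFiniteMeasure P] (σ : StoppingTime 𝓕) {A : Set Ω} (hA : MeasurableSet[σ.sigma] A)
    {X W : Lp ℝ ∞ P} {Z : LInf P σ}
    (hW : W =ᵐ[P] A.indicator fun ω => X ω - (Z : Lp ℝ ∞ P) ω) :
    price Φ σ W =ᵐ[P] A.indicator fun ω => price Φ σ X ω - (Z : Lp ℝ ∞ P) ω := by
  have hsub := Lp.coeFn_sub X (Z : Lp ℝ ∞ P)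
  have hon : ∀ᵐ ω ∂P, ω ∈ A → W ω = (X - (Z : Lp ℝ ∞ P) : Lp ℝ ∞ P) ω := by
    filter_upwards [hW, hsub] with ω e1 e2 hω
    rw [e1, e2, Set.indicator_of_mem hω]; rfl
  have hoff : ∀ᵐ ω ∂P, ω ∈ Aᶜ → W ω = (0 : Lp ℝ ∞ P) ω := by
    filter_upwards [hW, Lp.coeFn_zero ℝ ∞ P] with ω e1 e2 hω
    rw [e1, e2, Set.indicator_of_notMem hω]; rfl
  have htr : price Φ σ (X - (Z : Lp ℝ ∞ P)) = price Φ σ X - (Z : Lp ℝ ∞ P) := by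
    have := hΦ.price_add σ (X - (Z : Lp ℝ ∞ P)) Z
    rw [sub_add_cancel] at this
    rw [this, add_sub_cancel_right]
  have h1 := hΦ.price_le_on σ hA (hon.mono fun ω h hω => (h hω).le)
  have h2 := hΦ.price_le_on σ hA (hon.mono fun ω h hω => (h hω).ge)
  have h3 := hΦ.price_le_on σ hA.compl (hoff.mono fun ω h hω => (h hω).le)
  have h4 := hΦ.price_le_on σ hA.compl (hoff.mono fun ω h hω => (h hω).ge)
  rw [htr] at h1 h2
  rw [hΦ.price_zero] at h3 h4
  filter_upwards [h1, h2, h3, h4, Lp.coeFn_zero ℝ ∞ P,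
    Lp.coeFn_sub (price Φ σ X) (Z : Lp ℝ ∞ P)] with ω e1 e2 e3 e4 e5 e6
  by_cases hω : ω ∈ A
  · rw [Set.indicator_of_mem hω, le_antisymm (e1 hω) (e2 hω), e6]; rfl
  · rw [Set.indicator_of_notMem hω, le_antisymm (e3 hω) (e4 hω), e5]; rfl

/-- The cone of the claims with nonpositive price at time `0`. -/
def acceptanceCone (Φ : PriceFamily 𝓕 P) : Set (Lp ℝ ∞ P) :=
  {X | price Φ (StoppingTime.zero 𝓕) X ≤ 0}

theorem acceptanceCone_subset_staticCone : acceptanceCone Φ ⊆ staticCone Φ := fun X hX =>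
  ⟨1, zero_le_one, ofLp 𝓕 X, hX, (one_smul ℝ X).symm⟩

theorem IsTCPP.isAcceptanceCone (hΦ : IsTCPP Φ) (hsub : IsSublinear Φ) :
    IsAcceptanceCone (acceptanceCone Φ) := by
  have hD := hΦ.isDynamicPricingProcedure
  have hsmul : ∀ (l : ℝ), 0 < l → ∀ X : Lp ℝ ∞ P,
      price Φ (StoppingTime.zero 𝓕) (l • X) = l • price Φ (StoppingTime.zero 𝓕) X :=
    fun l hl X => congrArg Subtype.val (hsub _ _ (StoppingTime.zero 𝓕).le_infty l hl (ofLp 𝓕 X))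
  have hsmul0 : ∀ (l : ℝ), 0 < l → ∀ X : Lp ℝ ∞ P, X ≤ 0 → l • X ≤ 0 := by
    intro l hl X hX
    rw [← Lp.coeFn_le] at hX ⊢
    filter_upwards [hX, Lp.coeFn_smul l X, Lp.coeFn_zero ℝ ∞ P] with ω e1 e2 e3
    rw [e3] at e1 ⊢
    rw [e2, Pi.smul_apply, smul_eq_mul]
    exact mul_nonpos_of_nonneg_of_nonpos hl.le e1
  have hscale : ∀ (l : ℝ), 0 < l → ∀ X ∈ acceptanceCone Φ, l • X ∈ acceptanceCone Φ := by
    intro l hl X hX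
    change price Φ _ _ ≤ 0
    rw [hsmul l hl]
    exact hsmul0 l hl _ hX
  have hzero : (0 : Lp ℝ ∞ P) ∈ acceptanceCone Φ := (hD.price_zero _).le
  refine ⟨hzero, ?_, ?_, fun X hX Y hY => (hD.price_mono _ hY).trans hX, ?_⟩
  · intro X hX Y hY
    -- Convexity at the midpoint followed by scaling by 2 gives stability under addition.
    have h1 := hD.convex _ _ (StoppingTime.zero 𝓕).le_infty (ofLp 𝓕 X) (ofLp 𝓕 Y) (1 / 2)
      (by norm_num) (by norm_num)
    have h2 : price Φ (StoppingTime.zero 𝓕) ((1 / 2 : ℝ) • X + (1 - 1 / 2 : ℝ) • Y) ≤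
        (1 / 2 : ℝ) • price Φ (StoppingTime.zero 𝓕) X +
          (1 - 1 / 2 : ℝ) • price Φ (StoppingTime.zero 𝓕) Y := h1
    have h3 : (1 / 2 : ℝ) • X + (1 - 1 / 2 : ℝ) • Y ∈ acceptanceCone Φ :=
      h2.trans (add_nonpos (hsmul0 _ (by norm_num) _ hX) (hsmul0 _ (by norm_num) _ hY))
    have h4 := hscale 2 two_pos _ h3
    rw [smul_add, smul_smul, smul_smul] at h4
    norm_num at h4
    exact h4
  · intro X hX l hl
    rcases hl.eq_or_lt with rfl | hl
    · rwa [zero_smul]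
    · exact hscale l hl X hX
  · intro X Y hmono hX hlim
    have h1 := hΦ.isContinuousFromBelow _ _ (StoppingTime.zero 𝓕).le_infty
      (fun n => ofLp 𝓕 (X n)) (ofLp 𝓕 Y) (fun n k hnk => hmono hnk) hlim
    have h2 : ∀ n, price Φ (StoppingTime.zero 𝓕) (X n) ≤ 0 := hX
    simp only [← Lp.coeFn_le (price _ _ _)] at h2
    change price Φ _ _ ≤ 0
    rw [← Lp.coeFn_le]
    filter_upwards [h1, ae_all_iff.2 h2, Lp.coeFn_zero ℝ ∞ P] with ω e1 e2 e3
    rw [e3] at e2 ⊢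
    exact le_of_tendsto' e1 e2

theorem IsTCPP.price_mem_acceptanceCone_iff (hΦ : IsTCPP Φ) (σ : StoppingTime 𝓕) (X : Lp ℝ ∞ P) :
    price Φ σ X ∈ acceptanceCone Φ ↔ X ∈ acceptanceCone Φ := by
  change price Φ _ _ ≤ 0 ↔ price Φ _ _ ≤ 0
  rw [hΦ.price_price _ σ σ.zero_le]

end Procedure

end Pricing

/-! ### Representation of a sublinear TCPP -/

namespace Pricing

variable {Ω : Type*} {m : MeasurableSpace Ω} {𝓕 : Filtration ℝ≥0 m} {P : Measure Ω}

/-- The essential supremum of the conditional expectations exists in `L^∞(F_σ)`, and it is the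
supremum of countably many of them. -/
theorem exists_seq_condExp_isEssSup [IsFiniteMeasure P] {𝒬 : Set (Measure Ω)} (hne : 𝒬.Nonempty)
    (h𝒬 : 𝒬 ⊆ equivProb P) (σ : StoppingTime 𝓕) (X : Lp ℝ ∞ P) :
    ∃ Q : ℕ → Measure Ω, (∀ n, Q n ∈ 𝒬) ∧ ∃ Z : LInf P σ,
      (((Z : Lp ℝ ∞ P) : Ω → ℝ) =ᵐ[P] fun ω => ⨆ n, ((Q n)[X | σ.sigma]) ω) ∧
      IsEssSup P {f | ∃ Q ∈ 𝒬, f = Q[X | σ.sigma]} (Z : Lp ℝ ∞ P) := by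
  set 𝒢 : Set (Ω → ℝ) := {f | ∃ Q ∈ 𝒬, f = Q[(X : Ω → ℝ) | σ.sigma]} with h𝒢
  have hbound : ∀ f ∈ 𝒢, ∀ᵐ ω ∂P, |f ω| ≤ ‖X‖ := by
    rintro _ ⟨Q, hQ, rfl⟩
    exact ae_abs_condExp_le (h𝒬 hQ).2.1 (h𝒬 hQ).2.2 (ae_abs_le_norm X)
  have hmeas : ∀ f ∈ 𝒢, StronglyMeasurable[σ.sigma] f := by
    rintro _ ⟨Q, hQ, rfl⟩
    exact stronglyMeasurable_condExp
  obtain ⟨Q₀, hQ₀⟩ := hne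
  obtain ⟨f, hf, hess⟩ := exists_seq_iSup_isEssSup (P := P) (𝒢 := 𝒢) ⟨_, Q₀, hQ₀, rfl⟩
    (fun f hf => ((hmeas f hf).measurable.mono σ.sigma_le le_rfl).aemeasurable) hbound
  have hYm : Measurable[σ.sigma] fun ω => ⨆ n, f n ω :=
    Measurable.iSup fun n => (hmeas _ (hf n)).measurable
  have hYbd : ∀ᵐ ω ∂P, |⨆ n, f n ω| ≤ ‖X‖ := ae_abs_iSup_le fun n => hbound _ (hf n)
  obtain ⟨Z, hZ⟩ := exists_LInf (P := P) (τ := σ) hYm.stronglyMeasurable.aestronglyMeasurable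
    (memLp_top_of_abs_le (hYm.mono σ.sigma_le le_rfl).aestronglyMeasurable hYbd)
  choose Q hQ hfQ using hf
  refine ⟨Q, hQ, Z, ?_, hess.congr hZ.symm⟩
  simp only [← hfQ]
  exact hZ

section Representation

variable {Φ : PriceFamily 𝓕 P} [IsProbabilityMeasure P]

/-- For A in F_σ the claim 1_A(X - Π_σ(X)) has price 0 at σ by locality, hence at time 0, and so its
Q-expectation is nonpositive. -/
theorem IsTCPP.condExp_le_price (hΦ : IsTCPP Φ) {Q : Measure Ω}
    (hQ : Q ∈ pricingMeasures (acceptanceCone Φ)) (σ : StoppingTime 𝓕) (X : Lp ℝ ∞ P) :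
    Q[X | σ.sigma] ≤ᵐ[P] price Φ σ X := by
  obtain ⟨⟨hQ1, hQP, hPQ⟩, hQC⟩ := hQ
  obtain ⟨g, hgm, hg⟩ := aestronglyMeasurable_price Φ σ X
  have hgint : Integrable g Q :=
    (integrable_of_absolutelyContinuous hQP (price Φ σ X)).congr (hQP.ae_le hg)
  have hXint := integrable_of_absolutelyContinuous hQP X
  refine hPQ.ae_le (EventuallyLE.trans_eq ?_ (hQP.ae_eq hg).symm)
  refine ae_le_of_forall_setIntegral_le_sub σ.sigma_le stronglyMeasurable_condExp hgm
    integrable_condExp hgint fun A hA => ?_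
  rw [setIntegral_condExp σ.sigma_le hXint hA]
  let Z : LInf P σ := Φ.toInfty σ (ofLp 𝓕 X)
  have hWmem : MemLp (A.indicator fun ω => X ω - (Z : Lp ℝ ∞ P) ω) ∞ P :=
    ((Lp.memLp X).sub (Lp.memLp (Z : Lp ℝ ∞ P))).indicator hA.1
  have hW := hWmem.coeFn_toLp
  have h0 : price Φ σ (hWmem.toLp _) = 0 := by
    refine Lp.ext ?_
    filter_upwards [hΦ.isDynamicPricingProcedure.price_indicator_sub σ hA hW,
      Lp.coeFn_zero ℝ ∞ P] with ω e1 e2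
    rw [e1, e2]
    by_cases hω : ω ∈ A
    · rw [Set.indicator_of_mem hω]; exact sub_self _
    · rw [Set.indicator_of_notMem hω]; rfl
  have hmem : hWmem.toLp _ ∈ acceptanceCone Φ := by
    rw [← hΦ.price_mem_acceptanceCone_iff σ, h0]
    exact (hΦ.isDynamicPricingProcedure.price_zero _).le
  have h1 := hQC _ hmem
  rw [integral_congr_ae (hQP.ae_le hW), integral_indicator hA.1, integral_sub hXint.integrableOn
    (integrable_of_absolutelyContinuous hQP (Z : Lp ℝ ∞ P)).integrableOn,
    setIntegral_congr_ae (f := fun ω => (Z : Lp ℝ ∞ P) ω) (g := g) hA.1 (by filter_upwards [hQP.ae_eq hg] with ω h _ using h)] at h1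
  linarith

/-- For Y in C the pasting S satisfies E_S(Y) = E_Q(E_{Q'}(Y | F_σ)) ≤ E_Q(Π_σ(Y)) ≤ 0, because
Π_σ(Y) is again in C. -/
theorem IsTCPP.isStable_pricingMeasures (hΦ : IsTCPP Φ) :
    IsStable 𝓕 (pricingMeasures (acceptanceCone Φ)) := by
  intro Q hQ Q' hQ' σ
  have hQ1 := hQ.1.1
  obtain ⟨S, hS, hSint⟩ := exists_pasting (mσ := σ.sigma) σ.sigma_le hQ.1 hQ'.1
  refine ⟨S, ⟨hS, fun Y hY => ?_⟩, fun A hA => ?_⟩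
  · rw [hSint _ (Lp.memLp Y)]
    refine le_trans (integral_mono_ae
      (integrable_of_memLp_top (memLp_top_condExp σ.sigma_le hQ'.1.2.1 hQ'.1.2.2 (Lp.memLp Y))
        hQ.1.2.1) (integrable_of_absolutelyContinuous hQ.1.2.1 _)
      (hQ.1.2.1.ae_le (hΦ.condExp_le_price hQ' σ Y))) ?_
    exact hQ.2 _ ((hΦ.price_mem_acceptanceCone_iff σ Y).2 hY)
  · rw [← hSint _ (memLp_top_indicator_one hA), integral_indicator_const _ hA, smul_eq_mul, mul_one]

theorem IsTCPP.isRepresentedBy_pricingMeasures (hΦ : IsTCPP Φ) (hsub : IsSublinear Φ)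
    (hC0 : ∀ X ∈ acceptanceCone Φ, 0 ≤ X → X = 0) :
    IsRepresentedBy Φ (pricingMeasures (acceptanceCone Φ)) := by
  have hC := hΦ.isAcceptanceCone hsub
  obtain ⟨Q₀, hQ₀⟩ := hC.pricingMeasures_nonempty hC0
  intro σ τ hστ X₀
  rw [hΦ.eq_price σ τ hστ X₀]
  set X : Lp ℝ ∞ P := (X₀ : Lp ℝ ∞ P)
  obtain ⟨-, -, Z, -, hess⟩ := exists_seq_condExp_isEssSup ⟨Q₀, hQ₀⟩ (fun Q hQ => hQ.1) σ X
  obtain ⟨Y, hYm, hZ⟩ := LInf.aestronglyMeasurable Z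
  refine ⟨?_, fun W hW hWle => ?_⟩
  · rintro _ ⟨Q, hQ, rfl⟩
    exact hΦ.condExp_le_price hQ σ X
  refine EventuallyLE.trans ?_ (hess.2 W hW hWle)
  obtain ⟨g, hgm, hg⟩ := aestronglyMeasurable_price Φ σ X
  have hA : MeasurableSet[σ.sigma] {ω | Y ω < g ω} := measurableSet_lt hYm.measurable hgm.measurable
  -- The event where the price exceeds the essential supremum. The claim 1_A(X - Z) has nonpositive
  -- expectation under all pricing measures, and its price at σ is nonnegative.
  set A := {ω | Y ω < g ω} with hAdef
  have hVmem : MemLp (A.indicator fun ω => X ω - (Z : Lp ℝ ∞ P) ω) ∞ P :=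
    ((Lp.memLp X).sub (Lp.memLp (Z : Lp ℝ ∞ P))).indicator hA.1
  have hV := hVmem.coeFn_toLp
  have hVC : hVmem.toLp _ ∈ acceptanceCone Φ := by
    refine hC.mem_of_forall_pricingMeasures hC0 fun Q hQ => ?_
    have hQP := hQ.1.2.1
    have hQ1 := hQ.1.1
    have hXint := integrable_of_absolutelyContinuous hQP X
    have hZint := integrable_of_absolutelyContinuous hQP (Z : Lp ℝ ∞ P)
    rw [integral_congr_ae (hQP.ae_le hV), integral_indicator hA.1,
      integral_sub hXint.integrableOn hZint.integrableOn, ← setIntegral_condExp σ.sigma_le hXint hA,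
      sub_nonpos]
    refine integral_mono_ae integrable_condExp.integrableOn hZint.integrableOn
      (ae_restrict_of_ae (hQP.ae_le ?_))
    exact hess.1 _ ⟨Q, hQ, rfl⟩
  have hprice := hΦ.isDynamicPricingProcedure.price_indicator_sub σ hA hV
  have hnonneg : 0 ≤ price Φ σ (hVmem.toLp _) := by
    rw [← Lp.coeFn_nonneg]
    filter_upwards [hprice, hZ, hg] with ω e1 e2 e3
    rw [e1, Pi.zero_apply]
    by_cases hω : ω ∈ A
    · rw [Set.indicator_of_mem hω, e2, e3, sub_nonneg]
      exact le_of_lt hω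
    · rw [Set.indicator_of_notMem hω]
  have hzero := hC0 _ ((hΦ.price_mem_acceptanceCone_iff σ _).2 hVC) hnonneg
  rw [hzero] at hprice
  filter_upwards [hprice, hZ, hg, Lp.coeFn_zero ℝ ∞ P] with ω e1 e2 e3 e4
  by_cases hω : ω ∈ A
  · rw [Set.indicator_of_mem hω, e4, e2, Pi.zero_apply] at e1
    linarith
  · rw [e3, e2]
    exact not_lt.1 hω

/-- A sublinear TCPP without static free lunch is represented by a stable set of measures. -/
theorem IsTCPP.exists_stable_representation (hΦ : IsTCPP Φ) (hsub : IsSublinear Φ)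
    (hNFL : NoStaticFreeLunch Φ) :
    ∃ 𝒬 : Set (Measure Ω), 𝒬.Nonempty ∧ 𝒬 ⊆ equivProb P ∧ IsStable 𝓕 𝒬 ∧
      IsRepresentedBy Φ 𝒬 := by
  have hC0 : ∀ X ∈ acceptanceCone Φ, 0 ≤ X → X = 0 := by
    intro X hX hX0
    have h1 : X ∈ closure[weakStarTopology P] (staticCone Φ) ∩ {X | 0 ≤ X} :=
      ⟨@subset_closure _ (weakStarTopology P) _ _ (acceptanceCone_subset_staticCone hX), hX0⟩
    rw [hNFL] at h1
    exact h1
  exact ⟨pricingMeasures (acceptanceCone Φ),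
    (hΦ.isAcceptanceCone hsub).pricingMeasures_nonempty hC0, fun Q hQ => hQ.1,
    hΦ.isStable_pricingMeasures, hΦ.isRepresentedBy_pricingMeasures hsub hC0⟩

end Representation

theorem staticCone_subset_multiperiodCone {Φ : PriceFamily 𝓕 P} :
    staticCone Φ ⊆ multiperiodCone Φ := by
  rintro _ ⟨l, hl, X, hX, rfl⟩
  exact ⟨l, hl, X, ⟨0, Fin.elim0, X, Fin.elim0, Fin.elim0, fun i => i.elim0, fun i => i.elim0, hX,
    fun i => i.elim0, by simp⟩, rfl⟩

theorem zero_mem_staticCone {Φ : PriceFamily 𝓕 P} (hΦ : IsDynamicPricingProcedure Φ) :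
    0 ∈ staticCone Φ := acceptanceCone_subset_staticCone (hΦ.price_zero _).le

theorem NoMultiperiodFreeLunch.noStaticFreeLunch {Φ : PriceFamily 𝓕 P}
    (hΦ : IsDynamicPricingProcedure Φ) (h : NoMultiperiodFreeLunch Φ) : NoStaticFreeLunch Φ := by
  refine Set.Subset.antisymm ?_ ?_
  · rw [← h]
    exact Set.inter_subset_inter_left _
      (@closure_mono _ (weakStarTopology P) _ _ staticCone_subset_multiperiodCone)
  · rintro _ rfl
    exact ⟨@subset_closure _ (weakStarTopology P) _ _ (zero_mem_staticCone hΦ), (le_rfl : (0 : Lp ℝ ∞ P) ≤ 0)⟩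


end Pricing

/-! ### Stable sets: pasting and closure under maxima -/

namespace Pricing

variable {Ω : Type*} {m : MeasurableSpace Ω} {𝓕 : Filtration ℝ≥0 m} {P : Measure Ω}

section Pasting

/-- `S` is the pasting of `Q` and `Q'` at `σ`. -/
def IsPasting (σ : StoppingTime 𝓕) (Q Q' S : Measure Ω) : Prop :=
  ∀ A : Set Ω, MeasurableSet[m] A →
    S.real A = ∫ ω, (Q'[A.indicator (fun _ => (1 : ℝ)) | σ.sigma]) ω ∂Q

variable [IsFiniteMeasure P] {Q Q' S : Measure Ω}

theorem IsPasting.condExp_ae_eq {σ : StoppingTime 𝓕} (h : IsPasting σ Q Q' S)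
    (hQ : Q ∈ equivProb P) (hQ' : Q' ∈ equivProb P) (hS : S ∈ equivProb P) {ν : StoppingTime 𝓕}
    (hν : ν ≤ σ) {f : Ω → ℝ} (hf : MemLp f ∞ P) :
    S[f | ν.sigma] =ᵐ[P] Q[Q'[f | σ.sigma] | ν.sigma] := by
  have hint : ∀ {f : Ω → ℝ}, MemLp f ∞ P → ∫ ω, f ω ∂S = ∫ ω, (Q'[f | σ.sigma]) ω ∂Q :=
    fun hf => integral_eq_of_pasting σ.sigma_le hQ hQ' hS h hf
  have hQ1 := hQ.1
  have hQ'1 := hQ'.1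
  have hS1 := hS.1
  have hfσ : MemLp (Q'[f | σ.sigma]) ∞ P := memLp_top_condExp σ.sigma_le hQ'.2.1 hQ'.2.2 hf
  set g := Q[Q'[f | σ.sigma] | ν.sigma] with hg
  have hgm : StronglyMeasurable[ν.sigma] g := stronglyMeasurable_condExp
  have hgL : MemLp g ∞ P := memLp_top_condExp ν.sigma_le hQ.2.1 hQ.2.2 hfσ
  refine hS.2.2.ae_eq (EventuallyEq.symm ?_)
  refine ae_eq_condExp_of_forall_setIntegral_eq ν.sigma_le (integrable_of_memLp_top hf hS.2.1)
    (fun _ _ _ => (integrable_of_memLp_top hgL hS.2.1).integrableOn) (fun B hB _ => ?_)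
    hgm.aestronglyMeasurable
  have hBσ : MeasurableSet[σ.sigma] B := StoppingTime.sigma_mono hν B hB
  have hBgm : StronglyMeasurable[σ.sigma] (B.indicator g) :=
    (hgm.mono (StoppingTime.sigma_mono hν)).indicator hBσ
  rw [← integral_indicator hB.1, ← integral_indicator hB.1, hint (hgL.indicator hB.1),
    hint (hf.indicator hB.1), condExp_of_stronglyMeasurable σ.sigma_le hBgm
      (integrable_of_memLp_top (hgL.indicator hB.1) hQ'.2.1),
    integral_congr_ae ((hQ.2.1.trans hQ'.2.2).ae_eq
      (condExp_indicator (integrable_of_memLp_top hf hQ'.2.1) hBσ)),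
    integral_indicator hB.1, integral_indicator hB.1]
  exact setIntegral_condExp ν.sigma_le (integrable_of_memLp_top hfσ hQ.2.1) hB

/-- The stopping time `σ` on the complement of `A`, and `∞` on `A`. -/
theorem exists_infty_on (σ : StoppingTime 𝓕) {A : Set Ω} (hA : MeasurableSet[σ.sigma] A) :
    ∃ τ : StoppingTime 𝓕, (∀ ω ∈ A, τ.1 ω = ⊤) ∧ ∀ ω ∉ A, τ.1 ω = σ.1 ω := by
  classical
  refine ⟨⟨fun ω => if ω ∈ A then ⊤ else σ.1 ω, fun t => ?_⟩, fun ω hω => if_pos hω,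
    fun ω hω => if_neg hω⟩
  have : {ω | (if ω ∈ A then ⊤ else σ.1 ω) ≤ (t : WithTop ℝ≥0)} =
      Aᶜ ∩ {ω | σ.1 ω ≤ (t : WithTop ℝ≥0)} := by
    ext ω
    by_cases hω : ω ∈ A
    · simp only [Set.mem_ofPred_eq, hω, if_true, Set.mem_inter_iff, Set.mem_compl_iff,
        not_true_eq_false, false_and, iff_false]
      exact not_le.2 (WithTop.coe_lt_top t)
    · simp [hω]
  rw [this]
  exact hA.compl.2 t

/-- On A the σ-algebra F_τ has the same trace as F_∞, on the complement the same trace as F_σ. -/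
theorem condExp_infty_on_ae_eq {σ τ : StoppingTime 𝓕} {A : Set Ω}
    (hA : MeasurableSet[σ.sigma] A) (hστ : σ ≤ τ) (hτA : ∀ ω ∈ A, τ.1 ω = ⊤)
    (hτA' : ∀ ω ∉ A, τ.1 ω = σ.1 ω) [IsFiniteMeasure Q] {f : Ω → ℝ} (hf : Integrable f Q) :
    Q[f | τ.sigma] =ᵐ[Q] A.indicator f + Aᶜ.indicator (Q[f | σ.sigma]) := by
  have hAτ : MeasurableSet[τ.sigma] A := StoppingTime.sigma_mono hστ A hA
  have h1 : Q[f | τ.sigma] =ᵐ[Q.restrict A] Q[f | m] := by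
    refine condExp_ae_eq_restrict_of_measurableSpace_eq_on τ.sigma_le le_rfl hAτ fun t => ?_
    refine ⟨fun h => h.1, fun h => ⟨h, fun r => ?_⟩⟩
    have : A ∩ t ∩ {ω | τ.1 ω ≤ (r : WithTop ℝ≥0)} = ∅ := by
      refine Set.eq_empty_of_forall_notMem fun ω hω => ?_
      have h2 : τ.1 ω ≤ (r : WithTop ℝ≥0) := hω.2
      rw [hτA ω hω.1.1] at h2
      exact not_le.2 (WithTop.coe_lt_top r) h2
    rw [this]
    exact @MeasurableSet.empty Ω (𝓕 r)
  have h2 : Q[f | τ.sigma] =ᵐ[Q.restrict Aᶜ] Q[f | σ.sigma] := by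
    refine condExp_ae_eq_restrict_of_measurableSpace_eq_on τ.sigma_le σ.sigma_le hAτ.compl
      fun t => and_congr_right fun _ => forall_congr' fun r => ?_
    have : Aᶜ ∩ t ∩ {ω | τ.1 ω ≤ (r : WithTop ℝ≥0)} =
        Aᶜ ∩ t ∩ {ω | σ.1 ω ≤ (r : WithTop ℝ≥0)} := by
      ext ω
      refine and_congr_right fun hω => ?_
      simp only [Set.mem_ofPred_eq, hτA' ω hω.1]
    rw [this]
  have h3 : Q[f | m] =ᵐ[Q] f := condExp_of_aestronglyMeasurable' le_rfl hf.1 hf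
  rw [Filter.EventuallyEq, ae_restrict_iff' hA.1] at h1
  rw [Filter.EventuallyEq, ae_restrict_iff' hA.1.compl] at h2
  filter_upwards [h1, h2, h3] with ω e1 e2 e3
  by_cases hω : ω ∈ A
  · simp [hω, e1 hω, e3]
  · simp [hω, e2 hω]

variable {𝒬 : Set (Measure Ω)}

/-- Let A be the event where Q gives the larger conditional expectation. Pasting at the time that is
∞ on A and σ elsewhere keeps Q on A and switches to Q' at σ off A. -/
theorem IsStable.exists_condExp_eq_max (hst : IsStable 𝓕 𝒬) (h𝒬 : 𝒬 ⊆ equivProb P)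
    (hQ : Q ∈ 𝒬) (hQ' : Q' ∈ 𝒬) (σ : StoppingTime 𝓕) {f : Ω → ℝ} (hf : MemLp f ∞ P) :
    ∃ S ∈ 𝒬, S[f | σ.sigma] =ᵐ[P] fun ω => max ((Q[f | σ.sigma]) ω) ((Q'[f | σ.sigma]) ω) := by
  have hQ1 := (h𝒬 hQ).1
  have hQ'1 := (h𝒬 hQ').1
  have hQP := (h𝒬 hQ).2.1
  have hQ'P := (h𝒬 hQ').2.1
  have hPQ := (h𝒬 hQ).2.2
  have hPQ' := (h𝒬 hQ').2.2
  have hA : MeasurableSet[σ.sigma] {ω | (Q'[f | σ.sigma]) ω ≤ (Q[f | σ.sigma]) ω} :=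
    measurableSet_le stronglyMeasurable_condExp.measurable stronglyMeasurable_condExp.measurable
  set A := {ω | (Q'[f | σ.sigma]) ω ≤ (Q[f | σ.sigma]) ω} with hAdef
  obtain ⟨τ, hτA, hτA'⟩ := exists_infty_on σ hA
  have hστ : σ ≤ τ := by
    intro ω
    by_cases hω : ω ∈ A
    · rw [hτA ω hω]; exact le_top
    · exact (hτA' ω hω).ge
  obtain ⟨S, hS, hpaste⟩ := hst Q hQ Q' hQ' τ
  refine ⟨S, hS, ?_⟩
  have h1 := IsPasting.condExp_ae_eq hpaste (h𝒬 hQ) (h𝒬 hQ') (h𝒬 hS) hστ hf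
  have hfQ := integrable_of_memLp_top hf hQP
  have hfQ' := integrable_of_memLp_top hf hQ'P
  have hcint : Integrable (Q'[f | σ.sigma]) Q :=
    integrable_of_memLp_top (memLp_top_condExp σ.sigma_le hQ'P hPQ' hf) hQP
  have h2 := condExp_infty_on_ae_eq hA hστ hτA hτA' hfQ'
  have h3 : Q[Q'[f | τ.sigma] | σ.sigma] =ᵐ[Q]
      Q[A.indicator f + Aᶜ.indicator (Q'[f | σ.sigma]) | σ.sigma] :=
    condExp_congr_ae ((hQP.trans hPQ').ae_eq h2)
  have h4 := condExp_add (hfQ.indicator hA.1) (hcint.indicator hA.1.compl) σ.sigma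
  have h5 := condExp_indicator hfQ hA
  have h6 : Q[Aᶜ.indicator (Q'[f | σ.sigma]) | σ.sigma] = Aᶜ.indicator (Q'[f | σ.sigma]) :=
    condExp_of_stronglyMeasurable σ.sigma_le (stronglyMeasurable_condExp.indicator hA.compl)
      (hcint.indicator hA.1.compl)
  filter_upwards [h1, hPQ.ae_eq h3, hPQ.ae_eq h4, hPQ.ae_eq h5] with ω e1 e3 e4 e5
  rw [e1, e3, e4, Pi.add_apply, e5, h6]
  by_cases hω : ω ∈ A
  · have : (Q'[f | σ.sigma]) ω ≤ (Q[f | σ.sigma]) ω := hω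
    simp [hω, max_eq_left this]
  · have : (Q[f | σ.sigma]) ω ≤ (Q'[f | σ.sigma]) ω := (not_le.1 hω).le
    simp [hω, max_eq_right this]

/-- The essential supremum of the conditional expectations under the measures of a stable set is
the limit of a sequence of them. -/
theorem IsStable.exists_seq_tendsto (hst : IsStable 𝓕 𝒬) (h𝒬 : 𝒬 ⊆ equivProb P)
    (hne : 𝒬.Nonempty) (σ : StoppingTime 𝓕) (X : Lp ℝ ∞ P) {Y : Ω → ℝ} (hYm : AEMeasurable Y P)
    (hY : IsEssSup P {f | ∃ Q ∈ 𝒬, f = Q[X | σ.sigma]} Y) :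
    ∃ Q : ℕ → Measure Ω, (∀ n, Q n ∈ 𝒬) ∧
      ∀ᵐ ω ∂P, Tendsto (fun n => ((Q n)[X | σ.sigma]) ω) atTop (𝓝 (Y ω)) := by
  obtain ⟨Q, hQ, Z, hZ, hess⟩ := exists_seq_condExp_isEssSup hne h𝒬 σ X
  have hYZ : Y =ᵐ[P] fun ω => ⨆ n, ((Q n)[X | σ.sigma]) ω :=
    (hY.ae_eq hess hYm (Lp.aestronglyMeasurable _).aemeasurable).trans hZ
  have hstep : ∀ (n : ℕ) (S : 𝒬), ∃ S' : 𝒬, S'.1[X | σ.sigma] =ᵐ[P]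
      fun ω => max ((S.1[X | σ.sigma]) ω) (((Q (n + 1))[X | σ.sigma]) ω) := fun n S => by
    obtain ⟨S', h1, h2⟩ := hst.exists_condExp_eq_max h𝒬 S.2 (hQ (n + 1)) σ (Lp.memLp X)
    exact ⟨⟨S', h1⟩, h2⟩
  choose next hnext using hstep
  -- Running maxima of the countable family: the conditional expectations now increase to its
  -- supremum.
  let S : ℕ → 𝒬 := fun n => Nat.rec ⟨Q 0, hQ 0⟩ (fun n s => next n s) n
  refine ⟨fun n => (S n).1, fun n => (S n).2, ?_⟩
  have hS : ∀ᵐ ω ∂P, ∀ n, ((S (n + 1)).1[X | σ.sigma]) ω =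
      max (((S n).1[X | σ.sigma]) ω) (((Q (n + 1))[X | σ.sigma]) ω) :=
    ae_all_iff.2 fun n => hnext n (S n)
  have hub : ∀ᵐ ω ∂P, ∀ n, ((S n).1[X | σ.sigma]) ω ≤ Y ω :=
    ae_all_iff.2 fun n => hY.1 _ ⟨_, (S n).2, rfl⟩
  filter_upwards [hS, hub, hYZ] with ω e1 e2 e3
  have hmono : Monotone fun n => ((S n).1[X | σ.sigma]) ω :=
    monotone_nat_of_le_succ fun n => by rw [e1]; exact le_max_left _ _
  refine tendsto_atTop_isLUB hmono ⟨?_, fun b hb => ?_⟩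
  · rintro _ ⟨n, rfl⟩
    exact e2 n
  · rw [e3]
    refine ciSup_le fun n => le_trans ?_ (hb ⟨n, rfl⟩)
    cases n with
    | zero => exact le_rfl
    | succ n =>
      dsimp only
      rw [e1]
      exact le_max_right _ _

end Pasting

end Pricing

/-! ### Families represented by a stable set -/

namespace Pricing

variable {Ω : Type*} {m : MeasurableSpace Ω} {𝓕 : Filtration ℝ≥0 m} {P : Measure Ω}

theorem existsUnique_isRepresentedBy [IsFiniteMeasure P] {𝒬 : Set (Measure Ω)}
    (hne : 𝒬.Nonempty) (h𝒬 : 𝒬 ⊆ equivProb P) :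
    ∃! Φ : PriceFamily 𝓕 P, IsRepresentedBy Φ 𝒬 := by
  have hex : ∀ (σ τ : StoppingTime 𝓕) (_ : σ ≤ τ) (X : LInf P τ), ∃ Z : LInf P σ,
      IsEssSup P {f | ∃ Q ∈ 𝒬, f = Q[((X : Lp ℝ ∞ P) : Ω → ℝ) | σ.sigma]} (Z : Lp ℝ ∞ P) := by
    intro σ τ _ X
    obtain ⟨-, -, Z, -, hZ⟩ := exists_seq_condExp_isEssSup hne h𝒬 σ (X : Lp ℝ ∞ P)
    exact ⟨Z, hZ⟩
  choose Φ hΦ using hex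
  refine ⟨Φ, hΦ, fun Ψ hΨ => ?_⟩
  funext σ τ h X
  exact LInf.ext_ae ((hΨ σ τ h X).ae_eq (hΦ σ τ h X) (Lp.aestronglyMeasurable _).aemeasurable
    (Lp.aestronglyMeasurable _).aemeasurable)

section Represented

variable {𝒬 : Set (Measure Ω)} {Φ : PriceFamily 𝓕 P}

theorem IsRepresentedBy.condExp_le (hΦ : IsRepresentedBy Φ 𝒬) {σ τ : StoppingTime 𝓕} (h : σ ≤ τ)
    (X : LInf P τ) {Q : Measure Ω} (hQ : Q ∈ 𝒬) :
    Q[((X : Lp ℝ ∞ P) : Ω → ℝ) | σ.sigma] ≤ᵐ[P] (Φ σ τ h X : Lp ℝ ∞ P) :=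
  (hΦ σ τ h X).1 _ ⟨Q, hQ, rfl⟩

theorem IsRepresentedBy.le_of_forall (hΦ : IsRepresentedBy Φ 𝒬) {σ τ : StoppingTime 𝓕}
    (h : σ ≤ τ) (X : LInf P τ) {Z : Ω → ℝ} (hZ : AEMeasurable Z P)
    (hle : ∀ Q ∈ 𝒬, Q[((X : Lp ℝ ∞ P) : Ω → ℝ) | σ.sigma] ≤ᵐ[P] Z) :
    ((Φ σ τ h X : Lp ℝ ∞ P) : Ω → ℝ) ≤ᵐ[P] Z := by
  refine (hΦ σ τ h X).2 Z hZ ?_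
  rintro _ ⟨Q, hQ, rfl⟩
  exact hle Q hQ

theorem LInf.aemeasurable {τ : StoppingTime 𝓕} (X : LInf P τ) :
    AEMeasurable ((X : Lp ℝ ∞ P) : Ω → ℝ) P := (Lp.aestronglyMeasurable _).aemeasurable

theorem LInf.integrable {τ : StoppingTime 𝓕} (X : LInf P τ) {Q : Measure Ω}
    (hQ : Q ∈ equivProb P) : Integrable ((X : Lp ℝ ∞ P) : Ω → ℝ) Q :=
  have := hQ.1
  integrable_of_absolutelyContinuous hQ.2.1 (X : Lp ℝ ∞ P)

theorem LInf.condExp_self {τ : StoppingTime 𝓕} (X : LInf P τ) {Q : Measure Ω}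
    (hQ : Q ∈ equivProb P) :
    Q[((X : Lp ℝ ∞ P) : Ω → ℝ) | τ.sigma] =ᵐ[P] (X : Lp ℝ ∞ P) :=
  have := hQ.1
  hQ.2.2.ae_eq (condExp_of_aestronglyMeasurable' τ.sigma_le
    ((LInf.aestronglyMeasurable X).mono_ac hQ.2.1) (LInf.integrable X hQ))

theorem condExp_add_ae {X Y : Lp ℝ ∞ P} {Q : Measure Ω} (hQ : Q ∈ equivProb P)
    (mσ : MeasurableSpace Ω) :
    Q[((X + Y : Lp ℝ ∞ P) : Ω → ℝ) | mσ] =ᵐ[P] Q[(X : Ω → ℝ) | mσ] + Q[(Y : Ω → ℝ) | mσ] :=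
  have := hQ.1
  hQ.2.2.ae_eq ((condExp_congr_ae (hQ.2.1.ae_eq (Lp.coeFn_add X Y))).trans
    (condExp_add (integrable_of_absolutelyContinuous hQ.2.1 X)
      (integrable_of_absolutelyContinuous hQ.2.1 Y) mσ))

theorem condExp_smul_ae (c : ℝ) {X : Lp ℝ ∞ P} {Q : Measure Ω} (hQ : Q ∈ equivProb P)
    (mσ : MeasurableSpace Ω) :
    Q[((c • X : Lp ℝ ∞ P) : Ω → ℝ) | mσ] =ᵐ[P] c • Q[(X : Ω → ℝ) | mσ] :=
  hQ.2.2.ae_eq ((condExp_congr_ae (hQ.2.1.ae_eq (Lp.coeFn_smul c X))).trans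
    (condExp_smul c _ mσ))

theorem IsRepresentedBy.isDynamicPricingProcedure (hΦ : IsRepresentedBy Φ 𝒬) (hne : 𝒬.Nonempty)
    (h𝒬 : 𝒬 ⊆ equivProb P) : IsDynamicPricingProcedure Φ where
  monotone σ τ h X Y hXY := by
    rw [LInf.le_iff] at hXY ⊢
    refine hΦ.le_of_forall h X (LInf.aemeasurable _) fun Q hQ => ?_
    refine EventuallyLE.trans ?_ (hΦ.condExp_le h Y hQ)
    exact (h𝒬 hQ).2.2.ae_le (condExp_mono (LInf.integrable X (h𝒬 hQ)) (LInf.integrable Y (h𝒬 hQ))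
      ((h𝒬 hQ).2.1.ae_le hXY))
  translation σ τ h Z X := by
    have hkey : ∀ Q ∈ 𝒬, Q[((X + LInf.incl P h Z : LInf P τ) : Lp ℝ ∞ P) | σ.sigma] =ᵐ[P]
        Q[((X : Lp ℝ ∞ P) : Ω → ℝ) | σ.sigma] + ((Z : Lp ℝ ∞ P) : Ω → ℝ) := fun Q hQ =>
      (condExp_add_ae (X := (X : Lp ℝ ∞ P)) (Y := (Z : Lp ℝ ∞ P)) (h𝒬 hQ) σ.sigma).trans
        ((EventuallyEq.refl _ _).add (LInf.condExp_self Z (h𝒬 hQ)))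
    refine LInf.ext_ae (EventuallyLE.antisymm ?_ ?_)
    · refine hΦ.le_of_forall h _ (LInf.aemeasurable _) fun Q hQ => ?_
      filter_upwards [hkey Q hQ, hΦ.condExp_le h X hQ, LInf.coe_add_ae (Φ σ τ h X) Z]
        with ω e1 e2 e3
      rw [e1, e3]
      exact add_le_add_left e2 _
    · have h1 : ((Φ σ τ h X : Lp ℝ ∞ P) : Ω → ℝ) ≤ᵐ[P]
          ((Φ σ τ h (X + LInf.incl P h Z) : Lp ℝ ∞ P) : Ω → ℝ) - ((Z : Lp ℝ ∞ P) : Ω → ℝ) := by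
        refine hΦ.le_of_forall h X ((LInf.aemeasurable _).sub (LInf.aemeasurable _))
          fun Q hQ => ?_
        filter_upwards [hkey Q hQ, hΦ.condExp_le h (X + LInf.incl P h Z) hQ] with ω e1 e2
        rw [e1] at e2
        exact le_sub_iff_add_le.2 e2
      filter_upwards [h1, LInf.coe_add_ae (Φ σ τ h X) Z] with ω e1 e2
      rw [e2]
      exact le_sub_iff_add_le.1 e1
  convex σ τ h X Y l hl0 hl1 := by
    rw [LInf.le_iff]
    refine hΦ.le_of_forall h _ (LInf.aemeasurable _) fun Q hQ => ?_
    filter_upwards [condExp_add_ae (X := l • (X : Lp ℝ ∞ P)) (Y := (1 - l) • (Y : Lp ℝ ∞ P))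
        (h𝒬 hQ) σ.sigma, condExp_smul_ae l (X := (X : Lp ℝ ∞ P)) (h𝒬 hQ) σ.sigma,
      condExp_smul_ae (1 - l) (X := (Y : Lp ℝ ∞ P)) (h𝒬 hQ) σ.sigma,
      hΦ.condExp_le h X hQ, hΦ.condExp_le h Y hQ,
      LInf.coe_add_ae (l • Φ σ τ h X) ((1 - l) • Φ σ τ h Y), LInf.coe_smul_ae l (Φ σ τ h X),
      LInf.coe_smul_ae (1 - l) (Φ σ τ h Y)] with ω e1 e2 e3 e4 e5 e6 e7 e8
    refine e1.le.trans ?_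
    rw [e6, Pi.add_apply, Pi.add_apply, e2, e3, e7, e8]
    exact add_le_add (mul_le_mul_of_nonneg_left e4 hl0)
      (mul_le_mul_of_nonneg_left e5 (sub_nonneg.2 hl1))
  normalized σ τ h := by
    have hzero : ∀ Q ∈ 𝒬, Q[(((0 : LInf P τ) : Lp ℝ ∞ P) : Ω → ℝ) | σ.sigma] =ᵐ[P] 0 := by
      intro Q hQ
      refine (h𝒬 hQ).2.2.ae_eq ((condExp_congr_ae ((h𝒬 hQ).2.1.ae_eq (LInf.coe_zero_ae τ))).trans ?_)
      rw [condExp_zero]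
    obtain ⟨Q₀, hQ₀⟩ := hne
    refine LInf.ext_ae (EventuallyLE.antisymm ?_ ?_)
    · exact hΦ.le_of_forall h _ (LInf.aemeasurable _) fun Q hQ =>
        ((hzero Q hQ).trans (LInf.coe_zero_ae σ).symm).le
    · exact ((LInf.coe_zero_ae σ).trans (hzero Q₀ hQ₀).symm).le.trans (hΦ.condExp_le h 0 hQ₀)

theorem IsRepresentedBy.isSublinear (hΦ : IsRepresentedBy Φ 𝒬) (h𝒬 : 𝒬 ⊆ equivProb P) :
    IsSublinear Φ := by
  have hle : ∀ σ τ (h : σ ≤ τ) (l : ℝ), 0 < l → ∀ X : LInf P τ,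
      Φ σ τ h (l • X) ≤ l • Φ σ τ h X := by
    intro σ τ h l hl X
    rw [LInf.le_iff]
    refine hΦ.le_of_forall h _ (LInf.aemeasurable _) fun Q hQ => ?_
    filter_upwards [condExp_smul_ae l (X := (X : Lp ℝ ∞ P)) (h𝒬 hQ) σ.sigma,
      hΦ.condExp_le h X hQ, LInf.coe_smul_ae l (Φ σ τ h X)] with ω e1 e2 e3
    refine e1.le.trans ?_
    rw [e3]
    exact mul_le_mul_of_nonneg_left e2 hl.le
  intro σ τ h l hl X
  refine le_antisymm (hle σ τ h l hl X) ?_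
  -- The reverse inequality is the one already proved, applied to the factor l⁻¹ and the claim lX.
  have h1 := hle σ τ h l⁻¹ (inv_pos.2 hl) (l • X)
  rw [smul_smul, inv_mul_cancel₀ hl.ne', one_smul, LInf.le_iff] at h1
  rw [LInf.le_iff]
  filter_upwards [h1, LInf.coe_smul_ae l (Φ σ τ h X),
    LInf.coe_smul_ae l⁻¹ (Φ σ τ h (l • X))] with ω e1 e2 e3
  rw [e3] at e1
  rw [e2]
  simp only [Pi.smul_apply, smul_eq_mul] at e1 ⊢
  rwa [← le_inv_mul_iff₀ hl]

/-- For ≤, Π_{σ,τ}(X) is a limit of E_{q n}(X | F_σ), and conditioning these under Q on F_ν gives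
the conditional expectation of X under a pasting in 𝒬. For ≥, the tower property under a single Q
suffices. -/
theorem IsRepresentedBy.isTimeConsistent [IsFiniteMeasure P] (hΦ : IsRepresentedBy Φ 𝒬)
    (hne : 𝒬.Nonempty) (h𝒬 : 𝒬 ⊆ equivProb P) (hst : IsStable 𝓕 𝒬) : IsTimeConsistent Φ := by
  intro ν σ τ hνσ hστ X
  refine LInf.ext_ae (EventuallyLE.antisymm ?_ ?_)
  · refine hΦ.le_of_forall hνσ _ (LInf.aemeasurable _) fun Q hQ => ?_
    have hQ1 := (h𝒬 hQ).1
    obtain ⟨q, hq, hlim⟩ := hst.exists_seq_tendsto h𝒬 hne σ (X : Lp ℝ ∞ P)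
      (LInf.aemeasurable _) (hΦ σ τ hστ X)
    refine (h𝒬 hQ).2.2.ae_le (condExp_le_of_tendsto (M := ‖(X : Lp ℝ ∞ P)‖) ν.sigma_le
      (f := fun n => (q n)[((X : Lp ℝ ∞ P) : Ω → ℝ) | σ.sigma]) (fun n => ?_) (fun n => ?_)
      ((h𝒬 hQ).2.1.ae_le hlim) fun n => ?_)
    · exact (stronglyMeasurable_condExp.mono σ.sigma_le).aestronglyMeasurable
    · exact (h𝒬 hQ).2.1.ae_le (ae_abs_condExp_le (h𝒬 (hq n)).2.1 (h𝒬 (hq n)).2.2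
        (ae_abs_le_norm _))
    · obtain ⟨S, hS, hpaste⟩ := hst Q hQ (q n) (hq n) σ
      refine (h𝒬 hQ).2.1.ae_le ?_
      exact (IsPasting.condExp_ae_eq hpaste (h𝒬 hQ) (h𝒬 (hq n)) (h𝒬 hS) hνσ
        (LInf.memLp X)).symm.le.trans (hΦ.condExp_le (hνσ.trans hστ) X hS)
  · refine hΦ.le_of_forall _ X (LInf.aemeasurable _) fun Q hQ => ?_
    have hQ1 := (h𝒬 hQ).1
    refine EventuallyLE.trans ?_ (hΦ.condExp_le hνσ (Φ σ τ hστ X) hQ)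
    refine (h𝒬 hQ).2.2.ae_le ((condExp_condExp_of_le (StoppingTime.sigma_mono hνσ)
      σ.sigma_le).symm.le.trans ?_)
    exact condExp_mono integrable_condExp (LInf.integrable _ (h𝒬 hQ))
      ((h𝒬 hQ).2.1.ae_le (hΦ.condExp_le hστ X hQ))

/-- Each E_Q(· | F_σ) is continuous along the bounded sequence, so E_Q(Y | F_σ) lies below the
supremum of the prices of `X n`; an essential supremum inherits this bound. -/
theorem IsRepresentedBy.isContinuousFromBelow (hΦ : IsRepresentedBy Φ 𝒬) (hne : 𝒬.Nonempty)
    (h𝒬 : 𝒬 ⊆ equivProb P) : IsContinuousFromBelow Φ := by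
  intro σ τ h X Y hX hlim
  have hD := hΦ.isDynamicPricingProcedure hne h𝒬
  have hXmono : ∀ᵐ ω ∂P, ∀ n, (X 0 : Lp ℝ ∞ P) ω ≤ (X n : Lp ℝ ∞ P) ω :=
    ae_all_iff.2 fun n => LInf.le_iff.1 (hX (Nat.zero_le n))
  have hXsucc : ∀ᵐ ω ∂P, ∀ n, (X n : Lp ℝ ∞ P) ω ≤ (X (n + 1) : Lp ℝ ∞ P) ω :=
    ae_all_iff.2 fun n => LInf.le_iff.1 (hX n.le_succ)
  have hXY : ∀ᵐ ω ∂P, ∀ n, (X n : Lp ℝ ∞ P) ω ≤ (Y : Lp ℝ ∞ P) ω := by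
    filter_upwards [hXsucc, hlim] with ω e1 e2
    exact (monotone_nat_of_le_succ e1).ge_of_tendsto e2
  have hΦY : ∀ᵐ ω ∂P, ∀ n, (Φ σ τ h (X n) : Lp ℝ ∞ P) ω ≤ (Φ σ τ h Y : Lp ℝ ∞ P) ω :=
    ae_all_iff.2 fun n => LInf.le_iff.1 (hD.monotone _ _ _ _ _
      (LInf.le_iff.2 (hXY.mono fun ω e => e n)))
  have hΦsucc : ∀ᵐ ω ∂P, ∀ n,
      (Φ σ τ h (X n) : Lp ℝ ∞ P) ω ≤ (Φ σ τ h (X (n + 1)) : Lp ℝ ∞ P) ω :=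
    ae_all_iff.2 fun n => LInf.le_iff.1 (hD.monotone _ _ _ _ _ (hX n.le_succ))
  have hle : ((Φ σ τ h Y : Lp ℝ ∞ P) : Ω → ℝ) ≤ᵐ[P]
      fun ω => ⨆ n, (Φ σ τ h (X n) : Lp ℝ ∞ P) ω := by
    refine hΦ.le_of_forall h Y (AEMeasurable.iSup fun n => LInf.aemeasurable _) fun Q hQ => ?_
    have hQ1 := (h𝒬 hQ).1
    have hQP := (h𝒬 hQ).2.1
    refine (h𝒬 hQ).2.2.ae_le (condExp_le_of_tendsto
      (M := ‖(X 0 : Lp ℝ ∞ P)‖ + ‖(Y : Lp ℝ ∞ P)‖) σ.sigma_le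
      (f := fun n => (X n : Lp ℝ ∞ P)) (fun n => (LInf.integrable _ (h𝒬 hQ)).1)
      (fun n => hQP.ae_le ?_) (hQP.ae_le hlim) fun n => hQP.ae_le ?_)
    · filter_upwards [hXmono, hXY, ae_abs_le_norm (X 0 : Lp ℝ ∞ P),
        ae_abs_le_norm (Y : Lp ℝ ∞ P)] with ω e1 e2 e3 e4
      have h1 := neg_le_of_abs_le e3
      have h2 := le_of_abs_le e4
      have h3 := norm_nonneg (X 0 : Lp ℝ ∞ P)
      have h4 := norm_nonneg (Y : Lp ℝ ∞ P)
      rw [abs_le]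
      constructor <;> linarith [e1 n, e2 n]
    · filter_upwards [hΦ.condExp_le h (X n) hQ, hΦY] with ω e1 e2
      refine e1.trans (le_ciSup (f := fun n => (Φ σ τ h (X n) : Lp ℝ ∞ P) ω) ?_ n)
      exact ⟨_, by rintro _ ⟨k, rfl⟩; exact e2 k⟩
  filter_upwards [hΦY, hΦsucc, hle] with ω e1 e2 e3
  refine tendsto_atTop_isLUB (monotone_nat_of_le_succ e2) ⟨?_, fun b hb => ?_⟩
  · rintro _ ⟨n, rfl⟩
    exact e1 n
  · exact e3.trans (ciSup_le fun n => hb ⟨n, rfl⟩)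

/-- The expectation under `Q ≪ P` as a linear functional on `L^∞(P)`. -/
noncomputable def expectation (Q : Measure Ω) [IsFiniteMeasure Q] (hQ : Q ≪ P) :
    Lp ℝ ∞ P →ₗ[ℝ] ℝ where
  toFun X := ∫ ω, X ω ∂Q
  map_add' X Y := by
    rw [← integral_add (integrable_of_absolutelyContinuous hQ X)
      (integrable_of_absolutelyContinuous hQ Y)]
    exact integral_congr_ae (hQ.ae_eq (Lp.coeFn_add X Y))
  map_smul' c X := by
    rw [RingHom.id_apply, smul_eq_mul, ← integral_const_mul]
    exact integral_congr_ae (hQ.ae_eq (Lp.coeFn_smul c X))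

theorem expectation_mono {Q : Measure Ω} [IsFiniteMeasure Q] (hQ : Q ≪ P) {X Y : Lp ℝ ∞ P}
    (h : X ≤ Y) : expectation Q hQ X ≤ expectation Q hQ Y :=
  integral_mono_ae (integrable_of_absolutelyContinuous hQ X)
    (integrable_of_absolutelyContinuous hQ Y) (hQ.ae_le ((Lp.coeFn_le X Y).2 h))

/-- The density dQ/dP is in L¹(P), so E_Q is one of the functionals that define the weak* topology.
-/
theorem isClosed_expectation_nonpos [IsFiniteMeasure P] {Q : Measure Ω} [IsFiniteMeasure Q]
    (hQ : Q ≪ P) : IsClosed[weakStarTopology P] {X : Lp ℝ ∞ P | expectation Q hQ X ≤ 0} := by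
  have hint : Integrable (fun ω => (Q.rnDeriv P ω).toReal) P := Measure.integrable_toReal_rnDeriv
  let g : Lp ℝ 1 P := hint.toL1 _
  have hg : ∀ X : Lp ℝ ∞ P, expectation Q hQ X = ∫ ω, X ω * g ω ∂P := by
    intro X
    change ∫ ω, X ω ∂Q = _
    rw [← integral_rnDeriv_smul hQ]
    refine integral_congr_ae ?_
    filter_upwards [hint.coeFn_toL1] with ω e
    rw [e, smul_eq_mul, mul_comm]
  have hpre : {X : Lp ℝ ∞ P | expectation Q hQ X ≤ 0} =
      (fun (X : Lp ℝ ∞ P) (g : Lp ℝ 1 P) => ∫ ω, X ω * g ω ∂P) ⁻¹' {φ | φ g ≤ 0} := by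
    ext X
    simp only [Set.mem_ofPred_eq, Set.mem_preimage, hg]
  rw [hpre, isClosed_induced_iff]
  exact ⟨_, isClosed_le (continuous_apply g) continuous_const, rfl⟩

theorem IsRepresentedBy.expectation_le (hΦ : IsRepresentedBy Φ 𝒬) {σ τ : StoppingTime 𝓕}
    (h : σ ≤ τ) (X : LInf P τ) {Q : Measure Ω} (hQ : Q ∈ 𝒬) [IsFiniteMeasure Q] (hQP : Q ≪ P) :
    expectation Q hQP (X : Lp ℝ ∞ P) ≤ expectation Q hQP (Φ σ τ h X : Lp ℝ ∞ P) := by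
  change ∫ ω, (X : Lp ℝ ∞ P) ω ∂Q ≤ _
  rw [← integral_condExp σ.sigma_le]
  exact integral_mono_ae integrable_condExp (integrable_of_absolutelyContinuous hQP _)
    (hQP.ae_le (hΦ.condExp_le h X hQ))

/-- Each trade loses under Q: E_Q(Z_i) ≤ E_Q(Π_{τ_i}(Z_i)) ≤ -E_Q(Π_{τ_i}(-Y_i)) ≤ E_Q(Y_i). -/
theorem IsRepresentedBy.expectation_multiperiodCone_nonpos (hΦ : IsRepresentedBy Φ 𝒬)
    {Q : Measure Ω} (hQ : Q ∈ 𝒬) [IsFiniteMeasure Q] (hQP : Q ≪ P) {V : Lp ℝ ∞ P}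
    (hV : V ∈ multiperiodCone Φ) : expectation Q hQP V ≤ 0 := by
  obtain ⟨l, hl, _, ⟨n, τ, X₀, Y, Z, -, -, hX₀, hYZ, rfl⟩, rfl⟩ := hV
  rw [map_smul, smul_eq_mul, map_add, map_sum]
  refine mul_nonpos_of_nonneg_of_nonpos hl (add_nonpos ?_ (Finset.sum_nonpos fun i _ => ?_))
  · refine (hΦ.expectation_le (StoppingTime.zero 𝓕).le_infty X₀ hQ hQP).trans ?_
    rw [← map_zero (expectation Q hQP)]
    exact expectation_mono hQP hX₀
  · have h1 := hΦ.expectation_le (τ i).le_infty (Z i) hQ hQP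
    have h2 := hΦ.expectation_le (τ i).le_infty (-Y i) hQ hQP
    have h3 : expectation Q hQP (Φ.toInfty (τ i) (Z i) : Lp ℝ ∞ P) ≤
        expectation Q hQP (-(Φ.toInfty (τ i) (-Y i) : Lp ℝ ∞ P)) := expectation_mono hQP (hYZ i)
    rw [map_neg] at h3
    have h4 : expectation Q hQP ((-Y i : LInf P (StoppingTime.infty 𝓕)) : Lp ℝ ∞ P) =
        -expectation Q hQP (Y i : Lp ℝ ∞ P) := map_neg (expectation Q hQP) (Y i : Lp ℝ ∞ P)
    rw [map_sub]
    linarith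

theorem IsRepresentedBy.noMultiperiodFreeLunch [IsFiniteMeasure P] (hΦ : IsRepresentedBy Φ 𝒬)
    (hne : 𝒬.Nonempty) (h𝒬 : 𝒬 ⊆ equivProb P) : NoMultiperiodFreeLunch Φ := by
  have hD := hΦ.isDynamicPricingProcedure hne h𝒬
  obtain ⟨Q, hQ⟩ := hne
  obtain ⟨hQ1, hQP, hPQ⟩ := h𝒬 hQ
  refine Set.Subset.antisymm ?_ ?_
  · rintro X ⟨hX, hX0⟩
    have hX0' : 0 ≤ᵐ[P] X := (Lp.coeFn_nonneg X).2 hX0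
    have hle : expectation Q hQP X ≤ 0 :=
      (@closure_minimal _ (weakStarTopology P) _ _
        (fun V hV => hΦ.expectation_multiperiodCone_nonpos hQ hQP hV)
        (isClosed_expectation_nonpos hQP)) hX
    have hzero : ∫ ω, X ω ∂Q = 0 :=
      le_antisymm hle (integral_nonneg_of_ae (hQP.ae_le hX0'))
    rw [integral_eq_zero_iff_of_nonneg_ae (hQP.ae_le hX0')
      (integrable_of_absolutelyContinuous hQP X)] at hzero
    exact (Lp.eq_zero_iff_ae_eq_zero).2 (hPQ.ae_eq hzero)
  · rintro _ rfl
    exact ⟨@subset_closure _ (weakStarTopology P) _ _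
      (staticCone_subset_multiperiodCone (zero_mem_staticCone hD)),
      (le_rfl : (0 : Lp ℝ ∞ P) ≤ 0)⟩

end Represented

end Pricing

open Pricing
theorem mainTheorem5 {Ω : Type*} {m : MeasurableSpace Ω} (P : Measure Ω) [IsProbabilityMeasure P]
    (𝓕 : Filtration ℝ≥0 m) (husual : UsualConditions 𝓕 P) :
    (∀ Φ : PriceFamily 𝓕 P, IsTCPP Φ → IsSublinear Φ →
      (NoStaticFreeLunch Φ ∨ NoMultiperiodFreeLunch Φ) →
      ∃ 𝒬 : Set (Measure Ω), 𝒬.Nonempty ∧ 𝒬 ⊆ equivProb P ∧ IsStable 𝓕 𝒬 ∧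
        IsRepresentedBy Φ 𝒬) ∧
    (∀ 𝒬 : Set (Measure Ω), 𝒬.Nonempty → 𝒬 ⊆ equivProb P → IsStable 𝓕 𝒬 →
      (∃! Φ : PriceFamily 𝓕 P, IsRepresentedBy Φ 𝒬) ∧
      ∀ Φ : PriceFamily 𝓕 P, IsRepresentedBy Φ 𝒬 →
        IsTCPP Φ ∧ IsSublinear Φ ∧ NoStaticFreeLunch Φ ∧ NoMultiperiodFreeLunch Φ) := by
  refine ⟨fun Φ hΦ hsub hNFL => ?_, fun 𝒬 hne h𝒬 hst =>
    ⟨existsUnique_isRepresentedBy hne h𝒬, fun Φ hΦ => ?_⟩⟩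
  · exact hΦ.exists_stable_representation hsub
      (hNFL.elim id fun h => h.noStaticFreeLunch hΦ.isDynamicPricingProcedure)
  · have hD := hΦ.isDynamicPricingProcedure hne h𝒬
    have hM := hΦ.noMultiperiodFreeLunch hne h𝒬
    exact ⟨⟨hD, hΦ.isTimeConsistent hne h𝒬 hst, hΦ.isContinuousFromBelow hne h𝒬⟩,
      hΦ.isSublinear h𝒬, hM.noStaticFreeLunch hD, hM⟩
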